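/- Theorem 5.3. Let $R \neq 0$ be a commutative ring with unity with $\operatorname{char} R \neq 2$, let $G$ be a nonabelian group of exponent $4$ (finite or infinite), and let $\sigma : G \to \{\pm 1\}$ be a nontrivial group homomorphism with kernel $N$. Let $\varphi_\sigma : RG \to RG$ be the map $\varphi_\sigma\big(\sum_{g} r_g g\big) = \sum_{g} r_g\,\sigma(g)\, g^{-1}$ on the group ring, put $(RG)^-_{\varphi_\sigma} = \{x \in RG \mid \varphi_\sigma(x) = -x\}$ and $R_2 = \{r \in R \mid 2r = 0\}$. Assume that $N$ is abelian. Then $(RG)^-_{\varphi_\sigma}$ is commutative (that is, $xy = yx$ for all $x, y \in (RG)^-_{\varphi_\sigma}$) if and only if one of the following conditions holds. (i) $R_2 = \{0\}$ and $N$ is an elementary abelian $2$-group. (ii) There are an elementary abelian $2$-group $E$ (possibly trivial) and an isomorphism $G \cong Q_8 \times E$, where $Q_8$ is the quaternion group of order $8$, which maps $N$ onto $C_4 \times E$ for some cyclic subgroup $C_4$ of order $4$ of $Q_8$. (iii) There are an elementary abelian $2$-group $E$ (possibly trivial) and an isomorphism $G \cong G_{[16,4]} \times E$, where $G_{[16,4]}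 = \langle a, b \mid a^4 = b^4 = 1,\ ab = b^{-1}a \rangle$, which maps $N$ onto $\langle a, b^2 \rangle \times E$ or onto $\langle ab, b^2 \rangle \times E$. -/

import Mathlib

universe u

/-- The map `φ_σ : R[G] → R[G]`, `∑ r_g g ↦ ∑ r_g σ(g) g⁻¹`, attached to an orientation
homomorphism `σ : G → {±1}` (here `ℤˣ`). -/
noncomputable def orientationInvolution (R : Type*) [CommRing R] {G : Type*} [Group G]
    (σ : G →* ℤˣ) (x : MonoidAlgebra R G) : MonoidAlgebra R G :=
  x.coeff.sum fun g r => MonoidAlgebra.single g⁻¹ (r * (((σ g : ℤˣ) : ℤ) : R))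

/-- The set `(RG)⁻` of antisymmetric elements of `R[G]` with respect to `φ_σ`. -/
def antisymmetricElements (R : Type*) [CommRing R] {G : Type*} [Group G]
    (σ : G →* ℤˣ) : Set (MonoidAlgebra R G) :=
  {x | orientationInvolution R σ x = -x}

/-- `R₂ = {r ∈ R | 2 r = 0}`. -/
def twoTorsionSet (R : Type*) [CommRing R] : Set R :=
  {r | 2 * r = 0}

/-- Elementary abelian 2-groups (the trivial group included); commutativity is automatic. -/
def IsElementaryAbelianTwoGroup (E : Type*) [Group E] : Prop :=
  ∀ x : E, x ^ 2 = 1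

/-- The relators of the presentation `⟨a, b ∣ a⁴ = b⁴ = 1, a b = b⁻¹ a⟩`,
with `a` and `b` the generators number `0` and `1`. -/
def relatorsG16x4 : Set (FreeGroup (Fin 2)) :=
  {FreeGroup.of 0 ^ 4, FreeGroup.of 1 ^ 4,
    (FreeGroup.of 0 * FreeGroup.of 1) * ((FreeGroup.of 1)⁻¹ * FreeGroup.of 0)⁻¹}

/-- The group `G_[16,4] = ⟨a, b ∣ a⁴ = b⁴ = 1, a b = b⁻¹ a⟩`. -/
abbrev G16x4 : Type := PresentedGroup relatorsG16x4

/-- The generator `a` of `G_[16,4]`. -/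
def G16x4.a : G16x4 := PresentedGroup.of 0

/-- The generator `b` of `G_[16,4]`. -/
def G16x4.b : G16x4 := PresentedGroup.of 1

/-! Antisymmetric elements are sums of elements `r g - σ(g) r g⁻¹` and of elements `r g` with `g² =
1` and `r + σ(g) r = 0`, so commutativity is a condition on pairs of group elements.

Necessity. Comparing one coefficient in the two products of a pair of generators restricts the
group, because `2 ≠ 0`. If all squares in `N` are trivial, a nonzero `r` with `2r = 0` would force
`G` to be abelian. Otherwise there is no involution outside `N`, and the restrictions yield `a ∈ N`
and `b ∉ N` of order 4 with `ab = b⁻¹a`, where `b` centralizes the involutions of `N`, and these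
together with `a` generate `N` (`exists_isTwistedPair`). A complement `E` of `⟨a², b²⟩` in the group
of elements of `N` with trivial square is central, and `G = ⟨a, b⟩ × E`. The first factor is `Q₈` if
`a² = b²`, and `C₄ ⋊ C₄` if not (`IsTwistedPair.exists_decomposition`).

Sufficiency. In case (i), `gh = h⁻¹g⁻¹` for `g, h ∉ N`. In the other cases `HasCentralSquares`
provides central `s` and `u`: commutators lie in `{1, s}`, and `u` is the square of each element of
order 4 in `N`. Noncentral generators are multiples `g(1 - u)`, `g(1 + s)` or `g(1 + u)`. They
commute mainly because `s(1 + s) = 1 + s` and `(1 - u)(1 + u) = 0`. -/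

open MonoidAlgebra in
theorem coeff_orientationInvolution {R : Type*} [CommRing R] {G : Type*} [Group G] (σ : G →* ℤˣ)
    (x : MonoidAlgebra R G) (g : G) :
    (orientationInvolution R σ x).coeff g = (((σ g : ℤˣ) : ℤ) : R) * x.coeff g⁻¹ := by
  classical
  have hσ : σ g⁻¹ = σ g := by rcases Int.units_eq_one_or (σ g) with h | h <;> simp [h]
  rw [orientationInvolution, coeff_finsuppSum, Finsupp.sum_apply,
    Finsupp.sum_eq_single g⁻¹]
  · simp [coeff_single, hσ, mul_comm]
  · intro b _ hb
    rw [coeff_single, Finsupp.single_apply, if_neg]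
    rintro rfl
    simp at hb
  · simp

theorem mem_antisymmetricElements_iff {R : Type*} [CommRing R] {G : Type*} [Group G]
    {σ : G →* ℤˣ} {x : MonoidAlgebra R G} :
    x ∈ antisymmetricElements R σ ↔
      ∀ g, (((σ g : ℤˣ) : ℤ) : R) * x.coeff g⁻¹ = - x.coeff g := by
  rw [antisymmetricElements, Set.mem_ofPred_eq, ← MonoidAlgebra.coeff_inj, Finsupp.ext_iff]
  simp only [coeff_orientationInvolution]
  rfl

/-! ### Additive generators of the antisymmetric elements -/

section Generators

variable {R : Type*} [CommRing R] {G : Type*} [Group G] {σ : G →* ℤˣ}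

open MonoidAlgebra

theorem single_sub_single_inv_mem (g : G) (r : R) :
    single g r - single g⁻¹ ((((σ g : ℤˣ) : ℤ) : R) * r) ∈ antisymmetricElements R σ := by
  classical
  rw [mem_antisymmetricElements_iff]
  intro h
  simp only [coeff_sub, coeff_single, Finsupp.sub_apply, Finsupp.single_apply, inv_inj]
  by_cases h1 : g = h
  · subst h1
    by_cases hgg : g⁻¹ = g
    · rcases Int.units_eq_one_or (σ g) with h | h <;> simp [h, hgg]
    · rcases Int.units_eq_one_or (σ g) with h | h <;> simp [h, hgg, Ne.symm hgg]
  · by_cases h2 : g = h⁻¹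
    · subst h2
      rcases Int.units_eq_one_or (σ h) with h' | h' <;> simp [h', h1]
    · have h3 : g⁻¹ ≠ h := fun e => h2 (by rw [← e, inv_inv])
      simp [h1, h2, h3]

theorem single_mem_of_sq_eq_one {g : G} (hg : g ^ 2 = 1) {r : R}
    (hr : r + (((σ g : ℤˣ) : ℤ) : R) * r = 0) :
    single g r ∈ antisymmetricElements R σ := by
  classical
  have hinv : g⁻¹ = g := inv_eq_of_mul_eq_one_left (by rw [← sq, hg])
  rw [mem_antisymmetricElements_iff]
  intro h
  simp only [coeff_single, Finsupp.single_apply]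
  by_cases h1 : g = h
  · subst h1
    rw [hinv]
    simp only [if_true]
    linear_combination hr
  · have h2 : g ≠ h⁻¹ := fun e => h1 (by rw [← hinv, e, inv_inv])
    simp [h1, h2]

theorem sub_mem_antisymmetricElements {x y : MonoidAlgebra R G}
    (hx : x ∈ antisymmetricElements R σ) (hy : y ∈ antisymmetricElements R σ) :
    x - y ∈ antisymmetricElements R σ := by
  rw [mem_antisymmetricElements_iff] at *
  intro g
  simp only [coeff_sub, Finsupp.sub_apply]
  linear_combination hx g - hy g

/-- Every antisymmetric element is a sum of the elements `r g - σ(g) r g⁻¹` with `g ^ 2 ≠ 1` and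
of the antisymmetric elements `r g` with `g ^ 2 = 1`. -/
theorem antisymmetricElements_induction (S : AddSubgroup (MonoidAlgebra R G))
    (h₁ : ∀ (g : G) (r : R), g ^ 2 ≠ 1 → single g r - single g⁻¹ ((((σ g : ℤˣ) : ℤ) : R) * r) ∈ S)
    (h₂ : ∀ (g : G) (r : R), g ^ 2 = 1 → r + (((σ g : ℤˣ) : ℤ) : R) * r = 0 → single g r ∈ S)
    {x : MonoidAlgebra R G} (hx : x ∈ antisymmetricElements R σ) : x ∈ S := by
  classical
  induction hk : x.coeff.support.card using Nat.strong_induction_on generalizing x with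
  | _ k ih =>
    by_cases h0 : x = 0
    · rw [h0]; exact S.zero_mem
    obtain ⟨g, hg⟩ : ∃ g, x.coeff g ≠ 0 := by
      by_contra! h
      exact h0 (MonoidAlgebra.ext (Finsupp.ext h))
    -- Subtracting a `y` that agrees with `x` at `g` and is supported inside the support of `x`
    -- shrinks the support.
    have key : ∀ y ∈ antisymmetricElements R σ, y ∈ S → y.coeff g = x.coeff g →
        (∀ h, x.coeff h = 0 → y.coeff h = 0) → x ∈ S := by
      intro y hy hyS hyg hyh
      have : x - y ∈ S := by
        refine ih _ ?_ (sub_mem_antisymmetricElements hx hy) rfl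
        rw [← hk]
        refine Finset.card_lt_card (Finset.ssubset_iff_of_subset ?_ |>.2 ⟨g, ?_, ?_⟩)
        · intro h
          simp only [Finsupp.mem_support_iff, coeff_sub, Finsupp.sub_apply]
          intro hh hx0
          exact hh (by rw [hx0, hyh h hx0, sub_zero])
        · simpa using hg
        · simp [coeff_sub, hyg]
      simpa using S.add_mem this hyS
    have hxg := mem_antisymmetricElements_iff.1 hx g
    by_cases hg2 : g ^ 2 = 1
    · have hinv : g⁻¹ = g := inv_eq_of_mul_eq_one_left (by rw [← sq, hg2])
      have hr : x.coeff g + (((σ g : ℤˣ) : ℤ) : R) * x.coeff g = 0 := by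
        rw [hinv] at hxg
        linear_combination hxg
      refine key _ (single_mem_of_sq_eq_one hg2 hr) (h₂ g _ hg2 hr) (by simp [coeff_single]) ?_
      intro h hh
      rw [coeff_single, Finsupp.single_apply, if_neg]
      rintro rfl
      exact hg hh
    · have hne : g⁻¹ ≠ g := fun e => hg2 (by rw [sq]; nth_rw 1 [← e]; simp)
      refine key _ (single_sub_single_inv_mem g (x.coeff g)) (h₁ g _ hg2)
        (by simp [coeff_single, hne]) ?_
      intro h hh
      have n1 : g ≠ h := by rintro rfl; exact hg hh
      have n2 : g⁻¹ ≠ h := by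
        rintro rfl
        rw [hh] at hxg
        exact hg (by simpa using hxg)
      simp [coeff_single, n1, n2]

/-- To see that antisymmetric elements commute it suffices to compare the generators. -/
theorem antisymmetricElements_commute (P : MonoidAlgebra R G → Prop)
    (h₁ : ∀ (g : G) (r : R), g ^ 2 ≠ 1 → P (single g r - single g⁻¹ ((((σ g : ℤˣ) : ℤ) : R) * r)))
    (h₂ : ∀ (g : G) (r : R), g ^ 2 = 1 → r + (((σ g : ℤˣ) : ℤ) : R) * r = 0 → P (single g r))
    (h : ∀ x y, P x → P y → x * y = y * x) :
    ∀ x ∈ antisymmetricElements R σ, ∀ y ∈ antisymmetricElements R σ, x * y = y * x := by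
  have A : ∀ x, P x → ∀ y ∈ antisymmetricElements R σ, x * y = y * x := by
    intro x hx y hy
    have : y ∈ (Subring.centralizer {x}).toAddSubgroup := by
      refine antisymmetricElements_induction (σ := σ) _ (fun g r hg => ?_) (fun g r hg hr => ?_) hy
      · exact Subring.mem_centralizer_iff.2 fun z hz => by
          rw [Set.mem_singleton_iff.1 hz]; exact h _ _ hx (h₁ g r hg)
      · exact Subring.mem_centralizer_iff.2 fun z hz => by
          rw [Set.mem_singleton_iff.1 hz]; exact h _ _ hx (h₂ g r hg hr)
    exact Subring.mem_centralizer_iff.1 this x rfl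
  intro x hx y hy
  have : x ∈ (Subring.centralizer {y}).toAddSubgroup := by
    refine antisymmetricElements_induction (σ := σ) _ (fun g r hg => ?_) (fun g r hg hr => ?_) hx
    · exact Subring.mem_centralizer_iff.2 fun z hz => by
        rw [Set.mem_singleton_iff.1 hz]; exact (A _ (h₁ g r hg) y hy).symm
    · exact Subring.mem_centralizer_iff.2 fun z hz => by
        rw [Set.mem_singleton_iff.1 hz]; exact (A _ (h₂ g r hg hr) y hy).symm
  exact (Subring.mem_centralizer_iff.1 this y rfl).symm

end Generators

/-! ### Group relations forced by commutativity -/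

section Coefficients

variable {R : Type*} [CommRing R] {G : Type*} [Group G] {σ : G →* ℤˣ}

open MonoidAlgebra

theorem not_mem_ker_iff {x : G} : x ∉ σ.ker ↔ σ x = -1 := by
  rw [MonoidHom.mem_ker]
  rcases Int.units_eq_one_or (σ x) with h | h <;> simp [h]

theorem inv_eq_self_of_sq {x : G} (hx : x ^ 2 = 1) : x⁻¹ = x :=
  inv_eq_of_mul_eq_one_left (by rw [← sq, hx])

theorem inv_ne_self_of_sq {x : G} (hx : x ^ 2 ≠ 1) : x⁻¹ ≠ x :=
  fun e => hx (by rw [sq]; nth_rw 1 [← e]; simp)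

theorem single_sub_inv_mem {n : G} (hn : n ∈ σ.ker) :
    single n (1 : R) - single n⁻¹ 1 ∈ antisymmetricElements R σ := by
  simpa [MonoidHom.mem_ker.1 hn] using single_sub_single_inv_mem (σ := σ) n (1 : R)

theorem single_add_inv_mem {x : G} (hx : x ∉ σ.ker) :
    single x (1 : R) + single x⁻¹ 1 ∈ antisymmetricElements R σ := by
  simpa [not_mem_ker_iff.1 hx, sub_eq_add_neg, ← single_neg] using
    single_sub_single_inv_mem (σ := σ) x (1 : R)

theorem single_involution_mem {x : G} (hx : x ∉ σ.ker) (hx2 : x ^ 2 = 1) (r : R) :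
    single x r ∈ antisymmetricElements R σ :=
  single_mem_of_sq_eq_one hx2 (by simp [not_mem_ker_iff.1 hx])

theorem single_two_torsion_mem {n : G} (hn : n ∈ σ.ker) (hn2 : n ^ 2 = 1) {r : R}
    (hr : 2 * r = 0) : single n r ∈ antisymmetricElements R σ :=
  single_mem_of_sq_eq_one hn2 (by simp [MonoidHom.mem_ker.1 hn, ← two_mul, hr])

variable (hcomm : ∀ x ∈ antisymmetricElements R σ, ∀ y ∈ antisymmetricElements R σ, x * y = y * x)
include hcomm

/-- In `(n - n⁻¹)x` the coefficient of `nx` is 1. If `nx ≠ xn`, it is 0 or -1 in `x(n - n⁻¹)`. -/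
theorem commute_involution (h2 : (2 : R) ≠ 0) {x n : G} (hx : x ∉ σ.ker) (hx2 : x ^ 2 = 1)
    (hn : n ∈ σ.ker) (hn2 : n ^ 2 ≠ 1) : n * x = x * n := by
  classical
  by_contra hne
  have h := hcomm _ (single_sub_inv_mem hn) _ (single_involution_mem hx hx2 1)
  have h := congrArg (fun z => z.coeff (n * x)) h
  have hi := inv_ne_self_of_sq hn2
  simp only [sub_mul, mul_sub, single_mul_single, coeff_sub, coeff_single, Finsupp.sub_apply,
    Finsupp.single_apply, mul_one, mul_left_inj, hi, Ne.symm hne, if_true, if_false] at h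
  split_ifs at h
  · exact h2 (by linear_combination h)
  · exact h2 (by linear_combination 2 * h)

/-- Coefficient of `nx` in the products of `n - n⁻¹` and `x + x⁻¹`. The hypothesis `hxn` prevents
`-n⁻¹x⁻¹` from cancelling `nx`. If both conclusions fail, only negative terms remain on the other
side, and at most one of them equals `nx`. -/
theorem commute_or_of_sq_ne (h2 : (2 : R) ≠ 0) {x n : G} (hx : x ∉ σ.ker) (hx2 : x ^ 2 ≠ 1)
    (hn : n ∈ σ.ker) (hn2 : n ^ 2 ≠ 1) (hxn : n⁻¹ * x⁻¹ ≠ n * x) :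
    n * x = x * n ∨ n * x = x⁻¹ * n := by
  classical
  by_contra! hne
  have h := hcomm _ (single_sub_inv_mem hn) _ (single_add_inv_mem hx)
  have h := congrArg (fun z => z.coeff (n * x)) h
  have hi := inv_ne_self_of_sq hn2
  have hi' := inv_ne_self_of_sq hx2
  simp only [sub_mul, mul_sub, add_mul, mul_add, single_mul_single, coeff_sub, coeff_add,
    Finsupp.add_apply, coeff_single, Finsupp.sub_apply,
    Finsupp.single_apply, mul_one, mul_left_inj, mul_right_inj, hi, hi', hxn, Ne.symm hne.1,
    Ne.symm hne.2, if_true, if_false] at h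
  split_ifs at h with h3 h4
  · exact hi' (mul_right_cancel (h4.trans h3.symm))
  · exact h2 (by linear_combination h)
  · exact h2 (by linear_combination h)
  · exact h2 (by linear_combination 2 * h)

/-- The coefficient of `xy` in `(x + x⁻¹)(y + y⁻¹)` is 1 or 2, hence nonzero, so `xy` occurs in the
reversed product. -/
theorem mul_eq_of_not_mem_ker (h2 : (2 : R) ≠ 0) {x y : G} (hx : x ∉ σ.ker) (hx2 : x ^ 2 ≠ 1)
    (hy : y ∉ σ.ker) (hy2 : y ^ 2 ≠ 1) :
    x * y = y * x ∨ x * y = y * x⁻¹ ∨ x * y = y⁻¹ * x ∨ x * y = y⁻¹ * x⁻¹ := by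
  classical
  by_contra! hne
  have h := hcomm _ (single_add_inv_mem hx) _ (single_add_inv_mem hy)
  have h := congrArg (fun z => z.coeff (x * y)) h
  have hi := inv_ne_self_of_sq hx2
  have hi' := inv_ne_self_of_sq hy2
  simp only [add_mul, mul_add, single_mul_single, coeff_add,
    Finsupp.add_apply, coeff_single,
    Finsupp.single_apply, mul_one, mul_left_inj, mul_right_inj, hi, hi', Ne.symm hne.1,
    Ne.symm hne.2.1, Ne.symm hne.2.2.1, Ne.symm hne.2.2.2, if_true, if_false] at h
  split_ifs at h
  · exact h2 (by linear_combination h)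
  · exact h2 (by linear_combination 2 * h)

/-- Here `r n` is itself antisymmetric, and the term `r nx` must reappear as `r xn` or `r x⁻¹n`. -/
theorem commute_or_of_two_torsion {r : R} (hr : 2 * r = 0) (hr0 : r ≠ 0) {x n : G}
    (hx : x ∉ σ.ker) (hn : n ∈ σ.ker) (hn2 : n ^ 2 = 1) :
    n * x = x * n ∨ n * x = x⁻¹ * n := by
  classical
  by_contra! hne
  by_cases hx2 : x ^ 2 = 1
  · have h := hcomm _ (single_two_torsion_mem hn hn2 hr) _ (single_involution_mem hx hx2 1)
    have h := congrArg (fun z => z.coeff (n * x)) h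
    simp only [single_mul_single, coeff_single, Finsupp.single_apply, mul_one, one_mul,
      Ne.symm hne.1, if_true, if_false] at h
    exact hr0 h
  · have h := hcomm _ (single_two_torsion_mem hn hn2 hr) _ (single_add_inv_mem hx)
    have h := congrArg (fun z => z.coeff (n * x)) h
    simp only [add_mul, mul_add, coeff_add, Finsupp.add_apply, single_mul_single, coeff_single,
      Finsupp.single_apply, mul_one, one_mul, mul_right_inj, inv_ne_self_of_sq hx2,
      Ne.symm hne.1, Ne.symm hne.2, if_true, if_false, add_zero] at h
    exact hr0 h

end Coefficients

/-- A group-theoretic condition on a subgroup `N` (in practice abelian of index two) which makes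
the antisymmetric elements commute. -/
def HasCentralSquares {G : Type*} [Group G] (N : Subgroup G) : Prop :=
  ∃ s u : G, (∀ g, s * g = g * s) ∧ (∀ g, u * g = g * u) ∧ s ^ 2 = 1 ∧ u ^ 2 = 1 ∧
    (∀ g h, g * h = h * g ∨ g * h = s * (h * g)) ∧
    (∀ n ∈ N, (n ^ 2 = 1 ∧ ∀ g, n * g = g * n) ∨ (n ^ 2 = u ∧ n ^ 2 ≠ 1)) ∧
    (∀ g, g ∉ N → g ^ 2 ≠ 1 ∧ (g ^ 2 = s ∨ g ^ 2 = u)) ∧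
    ∀ g h, g ∉ N → h ∉ N → g ^ 2 = s ∨ h ^ 2 = s ∨ g * h = h * g

/-! ### Commutativity from the group structure -/

section Sufficiency

variable {R : Type*} [CommRing R] {G : Type*} [Group G] {σ : G →* ℤˣ}

open MonoidAlgebra

theorem single_comm {n : G} (hn : ∀ g, n * g = g * n) (r : R) (x : MonoidAlgebra R G) :
    single n r * x = x * single n r := by
  induction x using MonoidAlgebra.induction_linear with
  | zero => simp
  | add x y hx hy => rw [mul_add, add_mul, hx, hy]
  | single g t => rw [single_mul_single, single_mul_single, hn, mul_comm]

theorem inv_eq_mul_sq {g u : G} (hg : g ^ 2 = u) (hu : u ^ 2 = 1) : g⁻¹ = g * u := by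
  rw [inv_eq_iff_mul_eq_one, ← hg, ← pow_succ', ← pow_succ', ← hu, ← hg, ← pow_mul]

theorem antisymmetricElements_commute_of_hasCentralSquares
    (hN : ∀ x ∈ σ.ker, ∀ y ∈ σ.ker, x * y = y * x) (h : HasCentralSquares σ.ker) :
    ∀ x ∈ antisymmetricElements R σ, ∀ y ∈ antisymmetricElements R σ, x * y = y * x := by
  obtain ⟨s, u, hs, hu, hs2, hu2, hc, hin, hout, hoo⟩ := h
  have hsc := fun z => single_comm hs (1 : R) z
  have huc := fun z => single_comm hu (1 : R) z
  have hss : single s (1 : R) * single s 1 = 1 := by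
    rw [single_mul_single, ← sq, hs2, mul_one]; rfl
  have huu : single u (1 : R) * single u 1 = 1 := by
    rw [single_mul_single, ← sq, hu2, mul_one]; rfl
  -- The factor `1 + s` absorbs the commutator, since `s(1 + s) = 1 + s`.
  have hcs : ∀ g h : G, ∀ r t : R,
      single g r * single h t * (1 + single s 1) = single h t * single g r * (1 + single s 1) := by
    intro g h r t
    rcases hc g h with e | e
    · simp only [single_mul_single, e, mul_comm]
    · have : single g r * single h t = single h t * single g r * single s 1 := by
        simp only [single_mul_single, e, mul_one, hs, mul_comm]
      rw [this]
      linear_combination (norm := noncomm_ring) single h t * single g r * hss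
  have hcN : ∀ g ∈ σ.ker, ∀ h ∈ σ.ker, ∀ r t : R,
      single g r * single h t = single h t * single g r := by
    intro g hg h hh r t
    rw [single_mul_single, single_mul_single, hN g hg h hh, mul_comm]
  refine antisymmetricElements_commute (fun x =>
    (∀ y, x * y = y * x) ∨ (∃ n ∈ σ.ker, ∃ r, x = single n r * (1 - single u 1)) ∨
    (∃ g, g ∉ σ.ker ∧ g ^ 2 = s ∧ ∃ r, x = single g r * (1 + single s 1)) ∨
    (∃ g, g ∉ σ.ker ∧ g ^ 2 = u ∧ ∃ r, x = single g r * (1 + single u 1))) ?_ ?_ ?_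
  · intro g r hg2
    by_cases hg : g ∈ σ.ker
    · right; left
      rcases hin g hg with h | ⟨h, -⟩
      · exact absurd h.1 hg2
      · refine ⟨g, hg, r, ?_⟩
        rw [inv_eq_mul_sq h hu2, MonoidHom.mem_ker.1 hg, mul_sub, single_mul_single]
        simp
    · right; right
      rcases (hout g hg).2 with h | h
      · refine Or.inl ⟨g, hg, h, r, ?_⟩
        rw [inv_eq_mul_sq h hs2, not_mem_ker_iff.1 hg, mul_add, single_mul_single]
        simp [sub_eq_add_neg, ← single_neg]
      · refine Or.inr ⟨g, hg, h, r, ?_⟩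
        rw [inv_eq_mul_sq h hu2, not_mem_ker_iff.1 hg, mul_add, single_mul_single]
        simp [sub_eq_add_neg, ← single_neg]
  · intro g r hg2 _
    by_cases hg : g ∈ σ.ker
    · left
      rcases hin g hg with h | ⟨-, h⟩
      · exact single_comm h.2 r
      · exact absurd hg2 h
    · exact absurd hg2 (hout g hg).1
  · have hmul : ∀ z : MonoidAlgebra R G, (∀ y, z * y = y * z) → ∀ w, (∀ y, w * y = y * w) →
        ∀ a b : MonoidAlgebra R G, a * z * (b * w) = a * b * (z * w) := by
      intro z hz w hw a b
      rw [mul_assoc, ← mul_assoc z, hz b]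
      simp only [mul_assoc]
    have hzs : ∀ y : MonoidAlgebra R G, (1 + single s 1) * y = y * (1 + single s 1) := by
      intro y; rw [add_mul, mul_add, hsc, one_mul, mul_one]
    have hzu : ∀ y : MonoidAlgebra R G, (1 + single u 1) * y = y * (1 + single u 1) := by
      intro y; rw [add_mul, mul_add, huc, one_mul, mul_one]
    have hzu' : ∀ y : MonoidAlgebra R G, (1 - single u 1) * y = y * (1 - single u 1) := by
      intro y; rw [sub_mul, mul_sub, huc, one_mul, mul_one]
    have hz0 : (1 - single u (1 : R)) * (1 + single u 1) = 0 := by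
      linear_combination (norm := noncomm_ring) - huu
    have hz0' : (1 + single u (1 : R)) * (1 - single u 1) = 0 := by
      linear_combination (norm := noncomm_ring) - huu
    have hcs' : ∀ g h : G, ∀ r t : R, ∀ w, single g r * single h t * ((1 + single s 1) * w) =
        single h t * single g r * ((1 + single s 1) * w) := by
      intro g h r t w; rw [← mul_assoc, hcs, mul_assoc]
    rintro x y (hx | ⟨g, hg, r, rfl⟩ | ⟨g, hg, hgs, r, rfl⟩ | ⟨g, hg, hgs, r, rfl⟩)
      (hy | ⟨h, hh, t, rfl⟩ | ⟨h, hh, hhs, t, rfl⟩ | ⟨h, hh, hhs, t, rfl⟩)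
    iterate 4 exact hx _
    · exact (hy _).symm
    · rw [hmul _ hzu' _ hzu', hmul _ hzu' _ hzu', hcN g hg h hh]
    · rw [hmul _ hzu' _ hzs, hmul _ hzs _ hzu', hzu', hcs']
    · rw [hmul _ hzu' _ hzu, hmul _ hzu _ hzu', hz0, hz0', mul_zero, mul_zero]
    · exact (hy _).symm
    · rw [hmul _ hzu' _ hzs, hmul _ hzs _ hzu', hzu', hcs']
    · rw [hmul _ hzs _ hzs, hmul _ hzs _ hzs, hcs']
    · rw [hmul _ hzu _ hzs, hmul _ hzs _ hzu, hzu, hcs']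
    · exact (hy _).symm
    · rw [hmul _ hzu' _ hzu, hmul _ hzu _ hzu', hz0, hz0', mul_zero, mul_zero]
    · rw [hmul _ hzu _ hzs, hmul _ hzs _ hzu, hzu, hcs']
    -- No factor `1 + s` or `1 - u` is available here: the last clause of `HasCentralSquares` gives
    -- either `u = s` or `gh = hg`.
    · rw [hmul _ hzu _ hzu, hmul _ hzu _ hzu]
      rcases hoo g h hg hh with e | e | e
      · obtain rfl : u = s := hgs.symm.trans e
        rw [hcs']
      · obtain rfl : u = s := hhs.symm.trans e
        rw [hcs']
      · rw [single_mul_single, single_mul_single, e, mul_comm r]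

/-- For `g, h ∉ N` the product `gh` lies in `N`, so it is its own inverse and `gh = h⁻¹g⁻¹`.
Generators supported in `N` vanish because `R₂ = 0`. -/
theorem antisymmetricElements_commute_of_elementaryAbelian (h2 : twoTorsionSet R = {0})
    (hN : ∀ n ∈ σ.ker, n ^ 2 = 1) :
    ∀ x ∈ antisymmetricElements R σ, ∀ y ∈ antisymmetricElements R σ, x * y = y * x := by
  have hmem : ∀ g h, g ∉ σ.ker → h ∉ σ.ker → g * h ∈ σ.ker := by
    intro g h hg hh
    rw [MonoidHom.mem_ker, map_mul, not_mem_ker_iff.1 hg, not_mem_ker_iff.1 hh]; rfl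
  have hinv : ∀ g, g ∉ σ.ker → g⁻¹ ∉ σ.ker := fun g hg => by rwa [inv_mem_iff]
  have hsw : ∀ g h, g ∉ σ.ker → h ∉ σ.ker → g * h = h⁻¹ * g⁻¹ := by
    intro g h hg hh
    rw [← mul_inv_rev, inv_eq_self_of_sq (hN _ (hmem g h hg hh))]
  refine antisymmetricElements_commute (fun x => x = 0 ∨
    (∃ g, g ∉ σ.ker ∧ ∃ r, x = single g r + single g⁻¹ r) ∨
    (∃ g, g ∉ σ.ker ∧ g ^ 2 = 1 ∧ ∃ r, x = single g r)) ?_ ?_ ?_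
  · intro g r hg2
    by_cases hg : g ∈ σ.ker
    · exact absurd (hN g hg) hg2
    · refine Or.inr (Or.inl ⟨g, hg, r, ?_⟩)
      simp [not_mem_ker_iff.1 hg, sub_eq_add_neg, ← single_neg]
  · intro g r hg2 hr
    by_cases hg : g ∈ σ.ker
    · left
      have : r ∈ twoTorsionSet R := by
        change 2 * r = 0
        rw [MonoidHom.mem_ker.1 hg] at hr
        push_cast at hr
        linear_combination hr
      rw [h2, Set.mem_singleton_iff] at this
      rw [this, single_zero]
    · exact Or.inr (Or.inr ⟨g, hg, hg2, r, rfl⟩)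
  · rintro x y (rfl | ⟨g, hg, r, rfl⟩ | ⟨g, hg, hg2, r, rfl⟩)
      (rfl | ⟨h, hh, t, rfl⟩ | ⟨h, hh, hh2, t, rfl⟩)
    any_goals simp only [zero_mul, mul_zero]
    · simp only [add_mul, mul_add, single_mul_single]
      rw [hsw g h hg hh, hsw g h⁻¹ hg (hinv h hh), hsw g⁻¹ h (hinv g hg) hh,
        hsw g⁻¹ h⁻¹ (hinv g hg) (hinv h hh)]
      simp only [inv_inv, mul_comm r]
      abel
    · simp only [add_mul, mul_add, single_mul_single]
      rw [hsw g h hg hh, hsw g⁻¹ h (hinv g hg) hh, inv_eq_self_of_sq hh2]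
      simp only [inv_inv, mul_comm r]
      abel
    · simp only [add_mul, mul_add, single_mul_single]
      rw [hsw g h hg hh, hsw g h⁻¹ hg (hinv h hh), inv_eq_self_of_sq hg2]
      simp only [inv_inv, mul_comm r]
      abel
    · rw [single_mul_single, single_mul_single, hsw g h hg hh, inv_eq_self_of_sq hg2,
        inv_eq_self_of_sq hh2, mul_comm r]

end Sufficiency

/-- `a` and `b` generate, modulo the involutions of `N`, a copy of the quaternion group or of
`C₄ ⋊ C₄`. -/
structure IsTwistedPair {G : Type*} [Group G] (N : Subgroup G) (a b : G) : Prop where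
  left_mem : a ∈ N
  right_not_mem : b ∉ N
  left_sq_ne : a ^ 2 ≠ 1
  right_sq_ne : b ^ 2 ≠ 1
  mul_eq : a * b = b⁻¹ * a
  involution_comm : ∀ m ∈ N, m ^ 2 = 1 → m * b = b * m
  sq_eq_one_or : ∀ m ∈ N, m ^ 2 = 1 ∨ (a⁻¹ * m) ^ 2 = 1

/-! ### Existence of a twisted pair -/

section TwistedPair

variable {G : Type*} [Group G]

/-- If `x` centralized the abelian group `N`, then `G = N ∪ xN` would be abelian. -/
theorem exists_mem_not_comm {N : Subgroup G} (hmul : ∀ x y, x ∉ N → y ∉ N → x * y ∈ N)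
    (hN : ∀ x ∈ N, ∀ y ∈ N, x * y = y * x) (hG : ¬ ∀ x y : G, x * y = y * x) {x : G} (hx : x ∉ N) :
    ∃ n ∈ N, n * x ≠ x * n := by
  by_contra! hc
  have hcoset : ∀ g, g ∉ N → ∃ k ∈ N, g = x * k := fun g hg =>
    ⟨x⁻¹ * g, hmul _ _ (by rwa [inv_mem_iff]) hg, by simp⟩
  have hNx : ∀ m ∈ N, ∀ g, m * g = g * m := by
    intro m hm g
    by_cases hg : g ∈ N
    · exact hN m hm g hg
    · obtain ⟨k, hk, rfl⟩ := hcoset g hg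
      rw [← mul_assoc, hc m hm, mul_assoc, hN m hm k hk, mul_assoc]
  refine hG fun g h => ?_
  by_cases hg : g ∈ N
  · exact hNx g hg h
  · by_cases hh : h ∈ N
    · exact (hNx h hh g).symm
    · obtain ⟨k, hk, rfl⟩ := hcoset g hg
      obtain ⟨l, hl, rfl⟩ := hcoset h hh
      have hkl := hN k hk l hl
      have hkx := hc k hk
      have hlx := hc l hl
      rw [mul_assoc, mul_assoc, ← mul_assoc k, ← mul_assoc l, hkx, hlx, mul_assoc, mul_assoc,
        hkl]

theorem exists_sq_ne_one_not_comm {N : Subgroup G}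
    (hmul : ∀ x y, x ∉ N → y ∉ N → x * y ∈ N)
    (hN : ∀ x ∈ N, ∀ y ∈ N, x * y = y * x) (hG : ¬ ∀ x y : G, x * y = y * x)
    (hex : ∃ n ∈ N, n ^ 2 ≠ 1) {x : G} (hx : x ∉ N) :
    ∃ n ∈ N, n ^ 2 ≠ 1 ∧ n * x ≠ x * n := by
  obtain ⟨m, hm, hmx⟩ := exists_mem_not_comm hmul hN hG hx
  obtain ⟨n, hn, hn2⟩ := hex
  by_cases hnx : n * x = x * n
  · by_cases hm2 : m ^ 2 = 1
    -- Here `n` commutes with `x` and the involution `m` does not, so `nm` inherits `n² ≠ 1` from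
    -- one and noncommutation from the other.
    · refine ⟨n * m, mul_mem hn hm, ?_, ?_⟩
      · intro e
        have := hN n hn m hm
        rw [sq] at *
        clear hmul hN hG; grind
      · intro e
        refine hmx (mul_left_cancel (a := n) ?_)
        rw [← mul_assoc, e, ← mul_assoc, ← hnx, mul_assoc]
    · exact ⟨m, hm, hm2, hmx⟩
  · exact ⟨n, hn, hn2, hnx⟩

theorem exists_isTwistedPair {N : Subgroup G} (h4 : ∀ g : G, g ^ 4 = 1)
    (hmul : ∀ x y, x ∉ N → y ∉ N → x * y ∈ N)
    (hN : ∀ x ∈ N, ∀ y ∈ N, x * y = y * x) (hG : ¬ ∀ x y : G, x * y = y * x)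
    (hex : ∃ n ∈ N, n ^ 2 ≠ 1) (hne : ∃ x, x ∉ N)
    (hout : ∀ x, x ∉ N → x ^ 2 ≠ 1)
    (hmix : ∀ x n, x ∉ N → n ∈ N → n ^ 2 ≠ 1 → n⁻¹ * x⁻¹ ≠ n * x →
      n * x = x * n ∨ n * x = x⁻¹ * n)
    (hoo : ∀ x y, x ∉ N → y ∉ N →
      x * y = y * x ∨ x * y = y * x⁻¹ ∨ x * y = y⁻¹ * x ∨ x * y = y⁻¹ * x⁻¹) :
    ∃ a b, IsTwistedPair N a b := by
  have h4' : ∀ g : G, g * g * g * g = 1 := by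
    intro g; rw [← h4 g]; simp [pow_succ]
  have hnm : ∀ m ∈ N, ∀ x, x ∉ N → m * x ∉ N := by
    intro m hm x hx h
    exact hx (by simpa using N.mul_mem (N.inv_mem hm) h)
  -- Apply `hoo` to `b` and `mb`: the outer alternatives give `m² = 1`, the middle two `m² = b²`.
  have key : ∀ b, b ∉ N → ∀ m ∈ N, b * m = m⁻¹ * b → m * m = 1 ∨ m * m = b * b := by
    intro b hb m hm h
    have i1 := mul_inv_cancel m
    have i2 := inv_mul_cancel m
    have i3 := mul_inv_cancel b
    have i4 := inv_mul_cancel b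
    have q1 := h4' b
    have q2 := h4' m
    have hc := hN m hm _ (hmul b b hb hb)
    have := hoo b (m * b) hb (hnm m hm b hb)
    rw [mul_inv_rev] at this
    rcases this with e | e | e | e
    · left; clear * - i1 i2 i3 i4 q1 q2 hc h e; grind
    · right; clear * - i1 i2 i3 i4 q1 q2 hc h e; grind
    · right; clear * - i1 i2 i3 i4 q1 q2 hc h e; grind
    · left
      have f : m⁻¹ = m := by
        calc m⁻¹ = b * (b⁻¹ * m⁻¹ * b⁻¹) * b := by group
          _ = (b * b) * m * (b * b) := by rw [← e]; simp only [mul_assoc]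
          _ = m * (b * b * b * b) := by rw [← hc]; simp only [mul_assoc]
          _ = m := by rw [q1, mul_one]
      rw [← i1, f]
  obtain ⟨x, hx⟩ := hne
  obtain ⟨n, hn, hn2, hnx⟩ := exists_sq_ne_one_not_comm hmul hN hG hex hx
  by_cases hcase : ∃ y, y ∉ N ∧ y ^ 2 ≠ n ^ 2
  · have hny : ∀ y, y ∉ N → y ^ 2 ≠ n ^ 2 → n * y = y⁻¹ * n := by
      intro y hy hyn
      have hcond : n⁻¹ * y⁻¹ ≠ n * y := by
        intro e
        apply hyn
        have i1 := mul_inv_cancel n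
        have i2 := inv_mul_cancel n
        have i3 := mul_inv_cancel y
        have i4 := inv_mul_cancel y
        have q1 := h4' n
        have q2 := h4' y
        have hc := hN n hn _ (hmul y y hy hy)
        rw [sq, sq]
        clear * - i1 i2 i3 i4 q1 q2 hc e; grind
      rcases hmix y n hy hn hn2 hcond with e | e
      · exfalso
        -- If `n` commuted with `y`, it would commute with all of `yN`, which contains `x`.
        have e1 := hN n hn _ (hmul _ _ (by rwa [inv_mem_iff] : y⁻¹ ∉ N) hx)
        refine hnx ?_
        calc n * x = (n * y) * (y⁻¹ * x) := by group
          _ = y * (n * (y⁻¹ * x)) := by rw [e, mul_assoc]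
          _ = x * n := by rw [e1]; group
      · exact e
    obtain ⟨b, hb, hbn⟩ := hcase
    have hnb := hny b hb hbn
    have i1 := mul_inv_cancel n
    have i2 := inv_mul_cancel n
    have i3 := mul_inv_cancel b
    have i4 := inv_mul_cancel b
    have q1 := h4' n
    have q2 := h4' b
    have hsq : (n * b) * (n * b) = n * n := by clear * - i1 i2 i3 i4 q1 q2 hnb; grind
    have hb2 := hout b hb
    -- If `y² ≠ n²`, then `n` twists both `y` and `b` while commuting with `yb⁻¹ ∈ N`. This forces
    -- `y² = b²`.
    have hsqs : ∀ y, y ∉ N → y * y = b * b ∨ y * y = n * n := by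
      intro y hy
      by_cases hyn : y ^ 2 = n ^ 2
      · right; rwa [sq, sq] at hyn
      · left
        have e := hny y hy hyn
        have e1 := hN n hn _ (hmul _ _ hy (by rwa [inv_mem_iff] : b⁻¹ ∉ N))
        have f1 : n * b⁻¹ = b * n := by clear * - i3 i4 hnb; grind
        have f2 : y * b⁻¹ = y⁻¹ * b := by
          refine mul_right_cancel (b := n) ?_
          rw [← e1, ← mul_assoc, e, mul_assoc, f1, mul_assoc]
        calc y * y = y * (y * b⁻¹) * b := by group
          _ = b * b := by rw [f2]; group
    rw [sq, sq] at hbn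
    rw [sq] at hn2 hb2
    -- The element `nb` also inverts `m`, and `(nb)² = n² ≠ b²`, so `key` for `b` and for `nb`
    -- leaves only `m² = 1`.
    have hinv : ∀ m ∈ N, b * m = m⁻¹ * b → m * m = 1 := by
      intro m hm e
      rcases key b hb m hm e with h1 | h1
      · exact h1
      · have e' : (n * b) * m = m⁻¹ * (n * b) := by
          have := hN n hn _ (N.inv_mem hm)
          rw [mul_assoc, e, ← mul_assoc, this, mul_assoc]
        rcases key (n * b) (hnm n hn b hb) m hm e' with h2 | h2
        · exact h2
        · exact absurd (h1.symm.trans (h2.trans hsq)) hbn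
    -- If `(mb)² = b²`, then `b` inverts `m`. If `(mb)² = n²`, then `b` inverts `n⁻¹m`.
    have hdich : ∀ m ∈ N, b * m = m⁻¹ * b ∨ (n⁻¹ * m) * (n⁻¹ * m) = 1 := by
      intro m hm
      have j1 := mul_inv_cancel m
      have j2 := inv_mul_cancel m
      have j3 := hN m hm _ (hmul b b hb hb)
      have j4 := hN n hn m hm
      rcases hsqs (m * b) (hnm m hm b hb) with e | e
      · left; clear * - j1 j2 j3 i3 i4 q2 e; grind
      · right
        apply hinv _ (N.mul_mem (N.inv_mem hn) hm)
        rw [mul_inv_rev, inv_inv]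
        have f1 : b * n⁻¹ = n⁻¹ * b⁻¹ := by
          calc b * n⁻¹ = n⁻¹ * (n * b) * n⁻¹ := by group
            _ = n⁻¹ * b⁻¹ := by rw [hnb]; group
        have f2 : b * m * b = m⁻¹ * (n * n) := by rw [← e]; group
        have f3 : b⁻¹ = b * b * b := by clear * - i3 i4 q2; grind
        calc b * (n⁻¹ * m) = n⁻¹ * (b * (b * b * m)) := by
              rw [← mul_assoc, f1, f3]; simp only [mul_assoc]
          _ = n⁻¹ * (b * m * b) * b := by rw [← j3]; simp only [mul_assoc]
          _ = (n⁻¹ * m⁻¹) * (n * n) * b := by rw [f2]; simp only [mul_assoc]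
          _ = m⁻¹ * n * b := by rw [← mul_inv_rev, ← j4]; group
    refine ⟨n, b, hn, hb, by rwa [sq], by rwa [sq], hnb, ?_, ?_⟩
    · intro m hm hm2
      have hmi := inv_eq_self_of_sq hm2
      rw [sq] at hm2
      rcases hdich m hm with e | e
      · rw [e, hmi]
      · exfalso
        have j4 := hN n hn m hm
        apply hn2
        clear * - i1 i2 q1 hm2 e j4; grind
    · intro m hm
      rw [sq, sq]
      rcases hdich m hm with e | e
      · exact Or.inl (hinv m hm e)
      · exact Or.inr e
  · push Not at hcase
    have hb2 := hout x hx
    -- All squares outside `N` now agree, and `(mx)² = x²` says that `x` inverts `m`.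
    have hinv : ∀ m ∈ N, x * m = m⁻¹ * x := by
      intro m hm
      have e1 := hcase (m * x) (hnm m hm x hx)
      have e2 := hcase x hx
      rw [sq, sq] at e1 e2
      rw [← e2, ← mul_assoc] at e1
      rw [eq_inv_mul_iff_mul_eq, ← mul_assoc]
      exact mul_right_cancel e1
    have e2 := hcase x hx
    have i1 := mul_inv_cancel n
    have i2 := inv_mul_cancel n
    have i3 := mul_inv_cancel x
    have i4 := inv_mul_cancel x
    have q1 := h4' n
    have q2 := h4' x
    have e3 := hinv n hn
    refine ⟨n, x, hn, hx, hn2, hb2, ?_, ?_, ?_⟩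
    · rw [sq, sq] at e2
      clear * - i1 i2 i3 i4 q1 q2 e2 e3; grind
    · intro m hm hm2
      rw [hinv m hm, inv_eq_self_of_sq hm2]
    · intro m hm
      rw [sq, sq] at *
      rcases key x hx m hm (hinv m hm) with h | h
      · exact Or.inl h
      · right
        have j4 := hN _ (N.inv_mem hn) m hm
        calc n⁻¹ * m * (n⁻¹ * m) = n⁻¹ * (m * n⁻¹) * m := by simp only [mul_assoc]
          _ = n⁻¹ * n⁻¹ * (m * m) := by rw [← j4]; simp only [mul_assoc]
          _ = 1 := by rw [h, e2]; group

end TwistedPair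

/-! ### Complements and direct products -/

section Complement

variable {G : Type*} [Group G]

theorem mul_comm_of_sq_eq_one {K : Subgroup G} (hK : ∀ k ∈ K, k ^ 2 = 1) :
    ∀ x ∈ K, ∀ y ∈ K, x * y = y * x := by
  intro x hx y hy
  rw [← inv_eq_self_of_sq (hK _ (K.mul_mem hx hy)), mul_inv_rev, inv_eq_self_of_sq (hK x hx),
    inv_eq_self_of_sq (hK y hy)]

/-- `K` is a vector space over the field with two elements, and `E` is a linear complement of `H ∩
K`. -/
theorem exists_complement_of_sq_eq_one {K : Subgroup G} (hK : ∀ k ∈ K, k ^ 2 = 1) (H : Subgroup G) :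
    ∃ E ≤ K, (∀ x ∈ H, x ∈ E → x = 1) ∧ ∀ k ∈ K, ∃ h ∈ H, ∃ e ∈ E, k = h * e := by
  let _ : CommGroup K :=
    { (inferInstance : Group K) with
      mul_comm := fun x y => Subtype.ext (mul_comm_of_sq_eq_one hK x x.2 y y.2) }
  let _ : Module (ZMod 2) (Additive K) := AddCommGroup.zmodModule fun x =>
    Additive.toMul.injective (Subtype.ext (by simpa using hK _ (Additive.toMul x).2))
  obtain ⟨q, hq⟩ := exists_isCompl
    (AddSubgroup.toZModSubmodule 2 (Subgroup.toAddSubgroup (H.subgroupOf K)))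
  refine ⟨(AddSubgroup.toSubgroup q.toAddSubgroup).map K.subtype, ?_, ?_, ?_⟩
  · rintro _ ⟨x, -, rfl⟩
    exact x.2
  · rintro _ hx ⟨x, hxq, rfl⟩
    have := Submodule.disjoint_def.1 hq.disjoint (Additive.ofMul x) hx hxq
    have : x = 1 := this
    rw [this]; rfl
  · intro k hk
    obtain ⟨y, z, hy, hz, hyz⟩ :=
      Submodule.codisjoint_iff_exists_add_eq.1 hq.codisjoint (Additive.ofMul ⟨k, hk⟩)
    refine ⟨(Additive.toMul y : K), hy, (Additive.toMul z : K), ⟨Additive.toMul z, hz, rfl⟩, ?_⟩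
    exact (congrArg (fun t : Additive K => ((Additive.toMul t : K) : G)) hyz).symm

/-- A homomorphism `φ : W → G` and a subgroup `E` that centralizes its range, meets it trivially
and generates `G` together with it give a decomposition `G ≃* W × E`. -/
theorem exists_mulEquiv_prod {W : Type*} [Group W] (φ : W →* G) (E N : Subgroup G) (M : Subgroup W)
    (hcomm : ∀ w, ∀ e ∈ E, φ w * e = e * φ w) (hinj : ∀ w, φ w ∈ E → w = 1) (hEN : E ≤ N)
    (hM : ∀ w, w ∈ M ↔ φ w ∈ N) (htop : ∀ S : Subgroup G, φ.range ≤ S → E ≤ S → S = ⊤) :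
    ∃ f : G ≃* W × E, N.map f.toMonoidHom = M.prod ⊤ := by
  let ψ : W × E →* G := φ.noncommCoprod E.subtype fun w e => hcomm w e e.2
  have hψ : ∀ w e, ψ (w, e) = φ w * e := fun w e => rfl
  have hi : Function.Injective ψ := by
    rw [injective_iff_map_eq_one]
    rintro ⟨w, e⟩ h
    rw [hψ, mul_eq_one_iff_eq_inv] at h
    have hw := hinj w (h ▸ E.inv_mem e.2)
    subst hw
    rw [map_one, eq_comm, inv_eq_one] at h
    ext
    · rfl
    · exact h
  have hs : Function.Surjective ψ := by
    rw [← MonoidHom.range_eq_top]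
    refine htop _ ?_ ?_
    · rintro _ ⟨w, rfl⟩
      exact ⟨(w, 1), by simp [hψ]⟩
    · intro e he
      exact ⟨(1, ⟨e, he⟩), by simp [hψ]⟩
  let f := (MulEquiv.ofBijective ψ ⟨hi, hs⟩).symm
  refine ⟨f, ?_⟩
  have hf : ∀ p, f (ψ p) = p := fun p => (MulEquiv.ofBijective ψ ⟨hi, hs⟩).symm_apply_apply p
  have hmem : ∀ w e, ψ (w, e) ∈ N ↔ w ∈ M := by
    intro w e
    rw [hψ, hM, Subgroup.mul_mem_cancel_right _ (hEN e.2)]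
  ext ⟨w, e⟩
  rw [Subgroup.mem_prod]
  constructor
  · rintro ⟨g, hg, hge⟩
    obtain ⟨⟨w', e'⟩, rfl⟩ := hs g
    have : (w', e') = (w, e) := (hf _).symm.trans hge
    rw [this] at hg
    exact ⟨(hmem _ _).1 hg, trivial⟩
  · rintro ⟨hw, -⟩
    exact ⟨ψ (w, e), (hmem _ _).2 hw, hf _⟩

end Complement

/-! ### Groups generated by `a`, `b` of exponent 4 with `ab = b⁻¹a` -/

section NormalForm

variable {W : Type*} [Group W] {a b : W}

theorem left_comm_sq_right (hab : a * b = b⁻¹ * a) (hb : b ^ 4 = 1) : a * b ^ 2 = b ^ 2 * a := by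
  have h1 : b⁻¹ * b⁻¹ = b * b := by
    rw [← mul_inv_rev, inv_eq_iff_mul_eq_one, ← hb]; simp [pow_succ, mul_assoc]
  rw [sq, ← mul_assoc, hab, mul_assoc, hab, ← mul_assoc, h1]

theorem right_comm_sq_left (hab : a * b = b⁻¹ * a) : b * a ^ 2 = a ^ 2 * b := by
  have h : a * b⁻¹ = b * a := by
    have : b * (a * b) * b⁻¹ = b * (b⁻¹ * a) * b⁻¹ := by rw [hab]
    simpa [mul_assoc] using this.symm
  rw [sq, ← mul_assoc, ← h, mul_assoc, mul_assoc, hab]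

/-- From `ba = ab³` every word sorts to `a ^ i * b ^ j`. The parities of `i` and `j` select the
coset of `⟨a², b²⟩`. -/
theorem exists_normal_form (ha : a ^ 4 = 1) (hb : b ^ 4 = 1) (hab : a * b = b⁻¹ * a) {w : W}
    (hw : w ∈ Subgroup.closure {a, b}) : ∃ i j : ℕ, w = (a ^ 2) ^ i * (b ^ 2) ^ j ∨
      w = a * ((a ^ 2) ^ i * (b ^ 2) ^ j) ∨ w = b * ((a ^ 2) ^ i * (b ^ 2) ^ j) ∨
      w = a * b * ((a ^ 2) ^ i * (b ^ 2) ^ j) := by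
  have hb3 : b⁻¹ = b ^ 3 := by rw [inv_eq_iff_mul_eq_one, ← pow_succ', hb]
  have ha3 : a⁻¹ = a ^ 3 := by rw [inv_eq_iff_mul_eq_one, ← pow_succ', ha]
  have hba : b * a = a * b ^ 3 := by
    have : b * (a * b) * b⁻¹ = b * (b⁻¹ * a) * b⁻¹ := by rw [hab]
    rw [← hb3]
    simpa [mul_assoc] using this
  have hbja : ∀ j : ℕ, b ^ j * a = a * b ^ (3 * j) := by
    intro j
    induction j with
    | zero => simp
    | succ j ih => rw [pow_succ, mul_assoc, hba, ← mul_assoc, ih, mul_assoc, ← pow_add]; rfl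
  have hexp : ∃ i j : ℕ, w = a ^ i * b ^ j := by
    have hA : ∀ w : W, (∃ i j : ℕ, w = a ^ i * b ^ j) → ∃ i j : ℕ, w * a = a ^ i * b ^ j := by
      rintro _ ⟨i, j, rfl⟩
      exact ⟨i + 1, 3 * j, by rw [mul_assoc, hbja, ← mul_assoc, ← pow_succ]⟩
    have hB : ∀ w : W, (∃ i j : ℕ, w = a ^ i * b ^ j) → ∃ i j : ℕ, w * b = a ^ i * b ^ j := by
      rintro _ ⟨i, j, rfl⟩
      exact ⟨i, j + 1, by rw [mul_assoc, ← pow_succ]⟩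
    induction hw using Subgroup.closure_induction_right with
    | one => exact ⟨0, 0, by simp⟩
    | mul_right x hx y hy ih =>
      rcases hy with rfl | rfl
      · exact hA _ ih
      · exact hB _ ih
    | mul_inv_cancel x hx y hy ih =>
      rcases hy with rfl | rfl
      · rw [ha3, pow_succ, pow_succ, pow_one, ← mul_assoc, ← mul_assoc]
        exact hA _ (hA _ (hA _ ih))
      · rw [hb3, pow_succ, pow_succ, pow_one, ← mul_assoc, ← mul_assoc]
        exact hB _ (hB _ (hB _ ih))
  obtain ⟨i, j, rfl⟩ := hexp
  have hc : ∀ k, b * (a ^ 2) ^ k = (a ^ 2) ^ k * b := fun k =>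
    (Commute.pow_right (right_comm_sq_left hab : Commute b (a ^ 2)) k)
  rcases Nat.even_or_odd' i with ⟨k, rfl | rfl⟩ <;>
    rcases Nat.even_or_odd' j with ⟨l, rfl | rfl⟩ <;> refine ⟨k, l, ?_⟩
  · left; rw [pow_mul, pow_mul]
  · right; right; left
    rw [pow_mul a, pow_succ' b, pow_mul b, ← mul_assoc, ← mul_assoc, hc]
  · right; left; rw [pow_succ', pow_mul, pow_mul, mul_assoc]
  · right; right; right
    rw [pow_succ' a, pow_succ' b, pow_mul a, pow_mul b, mul_assoc a, ← mul_assoc _ b, ← hc]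
    simp only [mul_assoc]

/-- With one argument fixed, the condition is stable under products and inverses in the other, since
`s` is central with `s² = 1`. It is also symmetric. -/
theorem commutator_of_closure {s : W} (hs : ∀ g, s * g = g * s) (hs2 : s ^ 2 = 1) {S : Set W}
    (hS : ∀ g ∈ S, ∀ h ∈ S, g * h = h * g ∨ g * h = s * (h * g)) :
    ∀ g ∈ Subgroup.closure S, ∀ h ∈ Subgroup.closure S, g * h = h * g ∨ g * h = s * (h * g) := by
  have hss : s * s = 1 := by rw [← sq, hs2]
  have hsymm : ∀ g h : W, (g * h = h * g ∨ g * h = s * (h * g)) →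
      (h * g = g * h ∨ h * g = s * (g * h)) := by
    rintro g h (e | e)
    · exact Or.inl e.symm
    · right; rw [e, ← mul_assoc, hss, one_mul]
  have hstep : ∀ g, (∀ h ∈ S, g * h = h * g ∨ g * h = s * (h * g)) →
      ∀ h ∈ Subgroup.closure S, g * h = h * g ∨ g * h = s * (h * g) := by
    intro g hg h hh
    induction hh using Subgroup.closure_induction with
    | mem h hh => exact hg h hh
    | one => simp
    | mul x y _ _ hx hy =>
      have e1 : ∀ t, g * x = t * (x * g) → ∀ r, g * y = r * (y * g) → (∀ g, r * g = g * r) →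
          g * (x * y) = t * r * (x * y * g) := by
        intro t ht r hr hc
        rw [← mul_assoc, ht, mul_assoc, mul_assoc, hr, ← mul_assoc x, ← hc]
        simp only [mul_assoc]
      rw [← one_mul (x * g)] at hx
      rw [← one_mul (y * g)] at hy
      have h1 : ∀ g : W, 1 * g = g * 1 := by simp
      rcases hx with hx | hx <;> rcases hy with hy | hy
      · left; simpa using e1 _ hx _ hy h1
      · right; simpa using e1 _ hx s (by simpa using hy) hs
      · right; simpa using e1 s (by simpa using hx) 1 hy h1
      · left; simpa [hss] using e1 s (by simpa using hx) s (by simpa using hy) hs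
    | inv x _ hx =>
      rcases hx with hx | hx
      · left
        rw [eq_inv_mul_iff_mul_eq, ← mul_assoc, ← hx, mul_inv_cancel_right]
      · right
        rw [← mul_assoc, hs, mul_assoc, eq_inv_mul_iff_mul_eq, ← mul_assoc, mul_inv_eq_iff_eq_mul,
          mul_assoc, hx, ← mul_assoc, hss, one_mul]
  intro g hg h hh
  exact hstep g (fun k hk => hsymm _ _ (hstep k (hS k hk) g hg)) h hh

/-- Take `s = b²` and `u = a²`. Every element is `c`, `ac`, `bc` or `abc` with `c` central and `c² =
1`; the squares are `1`, `a²`, `b²`, `a²`. Arbitrary `a`, `b` are allowed so that `(ab, b)` can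
replace `(a, b)`. -/
theorem hasCentralSquares_closure (ha : a ^ 4 = 1) (hb : b ^ 4 = 1) (hab : a * b = b⁻¹ * a)
    (ha2 : a ^ 2 ≠ 1) (hb2 : b ^ 2 ≠ 1) (htop : Subgroup.closure {a, b} = (⊤ : Subgroup W))
    (hbM : b ∉ Subgroup.closure {a, b ^ 2}) :
    HasCentralSquares (Subgroup.closure {a, b ^ 2}) := by
  have hcen : ∀ z : W, z * a = a * z → z * b = b * z → ∀ g, z * g = g * z := by
    intro z hza hzb g
    have : g ∈ Subgroup.closure {a, b} := htop ▸ Subgroup.mem_top g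
    have hle : Subgroup.closure {a, b} ≤ Subgroup.centralizer {z} := by
      rw [Subgroup.closure_le]
      rintro x (rfl | rfl)
      · exact Subgroup.mem_centralizer_singleton_iff.2 hza.symm
      · exact Subgroup.mem_centralizer_singleton_iff.2 hzb.symm
    exact (Subgroup.mem_centralizer_singleton_iff.1 (hle this)).symm
  have hs : ∀ g, b ^ 2 * g = g * b ^ 2 :=
    hcen _ (left_comm_sq_right hab hb).symm (by rw [← pow_succ, ← pow_succ'])
  have hu : ∀ g, a ^ 2 * g = g * a ^ 2 :=
    hcen _ (by rw [← pow_succ, ← pow_succ']) (right_comm_sq_left hab).symm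
  have hs2 : (b ^ 2) ^ 2 = 1 := by rw [← pow_mul, hb]
  have hu2 : (a ^ 2) ^ 2 = 1 := by rw [← pow_mul, ha]
  have hform : ∀ w, ∃ c, (∀ g, c * g = g * c) ∧ c ^ 2 = 1 ∧ c ∈ Subgroup.closure {a, b ^ 2} ∧
      (w = c ∨ w = a * c ∨ w = b * c ∨ w = a * b * c) := by
    intro w
    obtain ⟨i, j, h⟩ := exists_normal_form ha hb hab (htop ▸ Subgroup.mem_top w)
    have c1 : ∀ g, (a ^ 2) ^ i * g = g * (a ^ 2) ^ i := fun g =>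
      (Commute.pow_left (hu g : Commute (a ^ 2) g) i)
    have c2 : ∀ g, (b ^ 2) ^ j * g = g * (b ^ 2) ^ j := fun g =>
      (Commute.pow_left (hs g : Commute (b ^ 2) g) j)
    refine ⟨(a ^ 2) ^ i * (b ^ 2) ^ j, fun g => ?_, ?_, ?_, h⟩
    · rw [mul_assoc, c2, ← mul_assoc, c1, mul_assoc]
    · rw [Commute.mul_pow (c1 _), pow_right_comm _ i, pow_right_comm _ j,
        hs2, hu2, one_pow, one_pow, one_mul]
    · exact Subgroup.mul_mem _
        (Subgroup.pow_mem _ (Subgroup.pow_mem _ (Subgroup.subset_closure (by simp)) _) _)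
        (Subgroup.pow_mem _ (Subgroup.subset_closure (by simp)) _)
  have haM : a ∈ Subgroup.closure {a, b ^ 2} := Subgroup.subset_closure (by simp)
  have hmulsq : ∀ x c : W, (∀ g, c * g = g * c) → c ^ 2 = 1 → (x * c) ^ 2 = x ^ 2 := by
    intro x c hc hc2
    rw [Commute.mul_pow (hc x).symm, hc2, mul_one]
  have habsq : (a * b) ^ 2 = a ^ 2 := by
    rw [sq, sq]
    nth_rw 1 [hab]
    rw [mul_assoc, ← mul_assoc a a b, ← sq, hu, ← mul_assoc, inv_mul_cancel, one_mul]
  have hbM' : ∀ c ∈ Subgroup.closure {a, b ^ 2}, b * c ∉ Subgroup.closure {a, b ^ 2} := by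
    intro c hc h
    exact hbM ((Subgroup.mul_mem_cancel_right _ hc).1 h)
  have habM' : ∀ c ∈ Subgroup.closure {a, b ^ 2}, a * b * c ∉ Subgroup.closure {a, b ^ 2} := by
    intro c hc h
    rw [mul_assoc] at h
    exact hbM' c hc ((Subgroup.mul_mem_cancel_left _ haM).1 h)
  refine ⟨b ^ 2, a ^ 2, hs, hu, hs2, hu2, ?_, ?_, ?_, ?_⟩
  · intro g h
    refine commutator_of_closure hs hs2 (S := {a, b}) ?_ g (htop ▸ Subgroup.mem_top g) h
      (htop ▸ Subgroup.mem_top h)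
    have hb3 : b ^ 2 * b = b⁻¹ := by rw [← pow_succ, eq_inv_iff_mul_eq_one, ← pow_succ, hb]
    have hab' : a * b = b ^ 2 * (b * a) := by rw [hab, ← mul_assoc, hb3]
    rintro x (rfl | rfl) y (rfl | rfl)
    · exact Or.inl rfl
    · exact Or.inr hab'
    · right; rw [hab', ← mul_assoc, ← sq, hs2, one_mul]
    · exact Or.inl rfl
  · intro n hn
    obtain ⟨c, hc, hc2, hcM, rfl | rfl | rfl | rfl⟩ := hform n
    · exact Or.inl ⟨hc2, hc⟩
    · right; rw [hmulsq _ _ hc hc2]; exact ⟨rfl, ha2⟩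
    · exact absurd hn (hbM' c hcM)
    · exact absurd hn (habM' c hcM)
  · intro n hn
    obtain ⟨c, hc, hc2, hcM, rfl | rfl | rfl | rfl⟩ := hform n
    · exact absurd hcM hn
    · exact absurd (Subgroup.mul_mem _ haM hcM) hn
    · rw [hmulsq _ _ hc hc2]; exact ⟨hb2, Or.inl rfl⟩
    · rw [hmulsq _ _ hc hc2, habsq]; exact ⟨ha2, Or.inr rfl⟩
  -- Outside the subgroup, `bc` has square `s`, and two elements `abc`, `abd` commute.
  · intro g h hg hh
    obtain ⟨c, hc, hc2, hcM, rfl | rfl | rfl | rfl⟩ := hform g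
    · exact absurd hcM hg
    · exact absurd (Subgroup.mul_mem _ haM hcM) hg
    · left; rw [hmulsq _ _ hc hc2]
    · obtain ⟨d, hd, hd2, hdM, rfl | rfl | rfl | rfl⟩ := hform h
      · exact absurd hdM hh
      · exact absurd (Subgroup.mul_mem _ haM hdM) hh
      · right; left; rw [hmulsq _ _ hd hd2]
      · right; right
        have : ∀ x : W, x * c * (x * d) = x * d * (x * c) := by
          intro x
          rw [mul_assoc x c, hc (x * d), mul_assoc x d (x * c), hd (x * c), mul_assoc x d c,
            mul_assoc x c d, hc d]
        exact this _

end NormalForm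

/-! ### Homomorphisms out of `Q₈` -/

section QuaternionHom

variable {G : Type*} [Group G]

theorem pow_zmod_val_add {a : G} (ha : a ^ 4 = 1) (i j : ZMod (2 * 2)) :
    a ^ (i + j).val = a ^ i.val * a ^ j.val := by
  rw [← pow_add, ZMod.val_add]
  exact (pow_eq_pow_mod _ ha).symm

theorem pow_zmod_val_sub {a : G} (ha : a ^ 4 = 1) (i j : ZMod (2 * 2)) :
    a ^ (i - j).val = (a ^ j.val)⁻¹ * a ^ i.val := by
  rw [eq_inv_mul_iff_mul_eq, ← pow_zmod_val_add ha, add_sub_cancel]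

/-- The homomorphism from the quaternion group of order eight given by a pair of elements
satisfying its defining relations. -/
def quaternionHom (a b : G) (ha : a ^ 4 = 1) (hab : a * b = b⁻¹ * a) (hsq : a ^ 2 = b ^ 2) :
    QuaternionGroup 2 →* G :=
  MonoidHom.mk' (fun
    | .a i => a ^ i.val
    | .xa i => b * a ^ i.val) <| by
    have hab' : a * b = b * a⁻¹ := by
      have hb : b⁻¹ = b * a ^ 2 := by
        rw [inv_eq_iff_mul_eq_one, ← mul_assoc, ← sq, ← hsq, ← pow_add, ha]
      have ha3 : a⁻¹ = a ^ 2 * a := by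
        rw [← pow_succ, inv_eq_iff_mul_eq_one, ← pow_succ', ha]
      rw [hab, hb, ha3, mul_assoc]
    have hconj : ∀ k : ℕ, a ^ k * b = b * (a ^ k)⁻¹ := by
      intro k
      have : SemiconjBy b a⁻¹ a := hab'.symm
      rw [← inv_pow]
      exact (this.pow_right k).symm
    rintro (i | i) (j | j)
    · exact pow_zmod_val_add ha i j
    · change b * a ^ (j - i).val = a ^ i.val * (b * a ^ j.val)
      rw [pow_zmod_val_sub ha, ← mul_assoc, ← mul_assoc, hconj]
    · change b * a ^ (i + j).val = b * a ^ i.val * a ^ j.val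
      rw [pow_zmod_val_add ha, mul_assoc]
    -- The summand 2 in the multiplication rule is accounted for by `b² = a²`.
    · change a ^ (((2 : ℕ) : ZMod (2 * 2)) + j - i).val = b * a ^ i.val * (b * a ^ j.val)
      rw [add_sub_assoc, pow_zmod_val_add ha, pow_zmod_val_sub ha,
        show (((2 : ℕ) : ZMod (2 * 2)).val) = 2 from rfl, hsq, mul_assoc b, ← mul_assoc _ b,
        hconj, sq]
      simp only [mul_assoc]

end QuaternionHom

/-! ### The group `G_[16,4]` -/

section G16x4

variable {G : Type*} [Group G]

/-- The homomorphism from `G16x4` given by a pair of elements satisfying its relations. -/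
def G16x4.lift (a b : G) (ha : a ^ 4 = 1) (hb : b ^ 4 = 1) (hab : a * b = b⁻¹ * a) :
    G16x4 →* G :=
  PresentedGroup.toGroup (f := ![a, b]) (rels := relatorsG16x4) <| by
    rintro r (rfl | rfl | rfl)
    · simpa using ha
    · simpa using hb
    · simp [hab]

variable {a b : G} (ha : a ^ 4 = 1) (hb : b ^ 4 = 1) (hab : a * b = b⁻¹ * a)

@[simp] theorem G16x4.lift_a : G16x4.lift a b ha hb hab G16x4.a = a :=
  PresentedGroup.toGroup.of _

@[simp] theorem G16x4.lift_b : G16x4.lift a b ha hb hab G16x4.b = b :=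
  PresentedGroup.toGroup.of _

theorem G16x4.a_pow_four : G16x4.a ^ 4 = 1 :=
  PresentedGroup.one_of_mem (rels := relatorsG16x4) (x := FreeGroup.of 0 ^ 4)
    (by simp [relatorsG16x4])

theorem G16x4.b_pow_four : G16x4.b ^ 4 = 1 :=
  PresentedGroup.one_of_mem (rels := relatorsG16x4) (x := FreeGroup.of 1 ^ 4)
    (by simp [relatorsG16x4])

theorem G16x4.a_mul_b : G16x4.a * G16x4.b = G16x4.b⁻¹ * G16x4.a :=
  mul_inv_eq_one.1 (PresentedGroup.one_of_mem (rels := relatorsG16x4)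
    (x := (FreeGroup.of 0 * FreeGroup.of 1) * ((FreeGroup.of 1)⁻¹ * FreeGroup.of 0)⁻¹)
    (by simp [relatorsG16x4]))

theorem G16x4.closure_eq_top : Subgroup.closure {G16x4.a, G16x4.b} = ⊤ := by
  rw [← PresentedGroup.closure_range_of relatorsG16x4]
  congr 1
  ext x
  simp [Fin.exists_fin_two, G16x4.a, G16x4.b, eq_comm]

/-- `Q₈` satisfies the relations, and the image of `a` there has order 4. -/
theorem G16x4.a_sq_ne_one : G16x4.a ^ 2 ≠ 1 := by
  intro h
  have := congrArg (G16x4.lift (QuaternionGroup.a 1 : QuaternionGroup 2) (QuaternionGroup.xa 0)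
    (by decide) (by decide) (by decide)) h
  rw [map_pow, G16x4.lift_a, map_one] at this
  revert this
  decide

theorem G16x4.b_sq_ne_one : G16x4.b ^ 2 ≠ 1 := by
  intro h
  have := congrArg (G16x4.lift (QuaternionGroup.a 1 : QuaternionGroup 2) (QuaternionGroup.xa 0)
    (by decide) (by decide) (by decide)) h
  rw [map_pow, G16x4.lift_b, map_one] at this
  revert this
  decide

/-- The sign character `χ` kills `c` and `b²` but not `b`. -/
theorem G16x4.b_not_mem {c : G16x4} (χ : G16x4 →* ℤˣ) (hc : χ c = 1) (hb : χ G16x4.b = -1) :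
    G16x4.b ∉ Subgroup.closure {c, G16x4.b ^ 2} := by
  intro h
  have hle : Subgroup.closure {c, G16x4.b ^ 2} ≤ χ.ker := by
    rw [Subgroup.closure_le]
    rintro x (rfl | rfl)
    · exact hc
    · exact MonoidHom.mem_ker.2 (by rw [map_pow, hb]; rfl)
  have := MonoidHom.mem_ker.1 (hle h)
  rw [hb] at this
  exact absurd this (by decide)

theorem G16x4.hasCentralSquares_left :
    HasCentralSquares (Subgroup.closure {G16x4.a, G16x4.b ^ 2}) :=
  hasCentralSquares_closure a_pow_four b_pow_four a_mul_b a_sq_ne_one b_sq_ne_one closure_eq_top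
    (b_not_mem (lift 1 (-1) (by decide) (by decide) (by decide)) (by simp) (by simp))

/-- The pair `(ab, b)` generates and satisfies the same relations as `(a, b)`, with `(ab)² = a²`. -/
theorem G16x4.hasCentralSquares_right :
    HasCentralSquares (Subgroup.closure {G16x4.a * G16x4.b, G16x4.b ^ 2}) := by
  have hsq : (a * b) ^ 2 = a ^ 2 := by
    have hr := right_comm_sq_left a_mul_b
    rw [sq, sq]
    nth_rw 1 [a_mul_b]
    rw [mul_assoc, ← mul_assoc a a b, ← sq, ← hr, ← mul_assoc, inv_mul_cancel, one_mul]
  refine hasCentralSquares_closure ?_ b_pow_four ?_ ?_ b_sq_ne_one ?_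
    (b_not_mem (lift (-1) (-1) (by decide) (by decide) (by decide)) (by simp) (by simp))
  · rw [show 4 = 2 * 2 from rfl, pow_mul, hsq, ← pow_mul]; exact a_pow_four
  · nth_rw 1 [a_mul_b]
    rw [mul_assoc]
  · rw [hsq]; exact a_sq_ne_one
  · rw [eq_top_iff, ← closure_eq_top, Subgroup.closure_le]
    have hb : b ∈ Subgroup.closure {a * b, b} := Subgroup.subset_closure (by simp)
    rintro x (rfl | rfl)
    · exact (Subgroup.mul_mem_cancel_right _ hb).1 (Subgroup.subset_closure (by simp))
    · exact hb

end G16x4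

/-- Both `s` and `u` are the unique involution, which is the square of every element of order 4. -/
theorem QuaternionGroup.hasCentralSquares_zpowers {c : QuaternionGroup 2} (hc : orderOf c = 4) :
    HasCentralSquares (Subgroup.zpowers c) := by
  have hc2 : c ^ 2 ≠ 1 := fun h => by
    have := orderOf_dvd_of_pow_eq_one h
    rw [hc] at this
    exact absurd this (by decide)
  have hall : ∀ g : QuaternionGroup 2, (g ^ 2 = 1 ∧ ∀ h, g * h = h * g) ∨
      g ^ 2 = QuaternionGroup.a 2 := by decide
  have hone : ∀ g : QuaternionGroup 2, g ^ 2 = 1 → g = 1 ∨ g = QuaternionGroup.a 2 := by decide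
  have hne : (QuaternionGroup.a 2 : QuaternionGroup 2) ≠ 1 := by decide
  have hout : ∀ g, g ∉ Subgroup.zpowers c → g ^ 2 = QuaternionGroup.a 2 := by
    intro g hg
    rcases hall g with h | h
    · exfalso
      apply hg
      rcases hone g h.1 with rfl | rfl
      · exact one_mem _
      · rcases hall c with h' | h'
        · exact absurd h'.1 hc2
        · rw [← h']
          exact Subgroup.pow_mem _ (Subgroup.mem_zpowers c) 2
    · exact h
  refine ⟨QuaternionGroup.a 2, QuaternionGroup.a 2, by decide, by decide, by decide, by decide,
    by decide, ?_, ?_, ?_⟩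
  · intro n _
    rcases hall n with h | h
    · exact Or.inl h
    · exact Or.inr ⟨h, by rw [h]; exact hne⟩
  · intro g hg
    rw [hout g hg]
    exact ⟨hne, Or.inl rfl⟩
  · intro g _ hg _
    exact Or.inl (hout g hg)

/-- Squares and commutators of `W × E` have trivial `E`-component, so `(s, 1)` and `(u, 1)` serve.
-/
theorem HasCentralSquares.of_mulEquiv_prod {G W E : Type*} [Group G] [Group W] [Group E]
    (hE : IsElementaryAbelianTwoGroup E) (f : G ≃* W × E) {N : Subgroup G} {M : Subgroup W}
    (hNM : N.map f.toMonoidHom = M.prod ⊤) (hM : HasCentralSquares M) : HasCentralSquares N := by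
  obtain ⟨s, u, hs, hu, hs2, hu2, hc, hin, hout, hoo⟩ := hM
  have hEc : ∀ x y : E, x * y = y * x := by
    intro x y
    rw [← inv_eq_self_of_sq (hE (x * y)), mul_inv_rev, inv_eq_self_of_sq (hE x),
      inv_eq_self_of_sq (hE y)]
  have hmem : ∀ g, g ∈ N ↔ (f g).1 ∈ M := by
    intro g
    have h1 : f g ∈ N.map f.toMonoidHom ↔ g ∈ N :=
      Subgroup.mem_map_iff_mem (f := f.toMonoidHom) f.injective
    rw [← h1, hNM, Subgroup.mem_prod]
    simp
  have hext : ∀ g h : G, (f g).1 = (f h).1 → (f g).2 = (f h).2 → g = h := fun g h h1 h2 =>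
    f.injective (Prod.ext h1 h2)
  have hsq2 : ∀ (g : G) (t : W), g ^ 2 = f.symm (t, 1) ↔ (f g).1 ^ 2 = t := by
    intro g t
    rw [← f.injective.eq_iff, f.apply_symm_apply, map_pow, Prod.ext_iff]
    simp [hE (f g).2]
  have hsq1 : ∀ g : G, g ^ 2 = 1 ↔ (f g).1 ^ 2 = 1 := by
    intro g
    rw [← hsq2, ← Prod.one_eq_mk, map_one]
  refine ⟨f.symm (s, 1), f.symm (u, 1), ?_, ?_, ?_, ?_, ?_, ?_, ?_, ?_⟩
  · intro g; apply hext <;> simp [hs]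
  · intro g; apply hext <;> simp [hu]
  · rw [hsq1]; simpa using hs2
  · rw [hsq1]; simpa using hu2
  · intro g h
    rcases hc (f g).1 (f h).1 with e | e
    · left; apply hext <;> simp [e, hEc (f g).2]
    · right; apply hext <;> simp [e, hEc (f g).2]
  · intro n hn
    rw [hsq2, hsq1]
    rcases hin _ ((hmem n).1 hn) with h | h
    · refine Or.inl ⟨h.1, fun g => ?_⟩
      apply hext
      · simpa using h.2 _
      · simpa using hEc _ _
    · exact Or.inr ⟨h.1, by rw [ne_eq, hsq1]; exact h.2⟩
  · intro g hg
    rw [hmem] at hg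
    simpa only [ne_eq, hsq1, hsq2] using hout _ hg
  · intro g h hg hh
    rw [hmem] at hg hh
    rw [hsq2, hsq2]
    refine (hoo _ _ hg hh).imp id (Or.imp id fun e => ?_)
    apply hext
    · simpa using e
    · simpa using hEc _ _

/-! ### Splitting `G` along a twisted pair -/

section Decomposition

variable {G : Type u} [Group G]

/-- `K` consists of the `m ∈ N` with `m² = 1`, so `N = K ∪ aK`, and `K = ⟨a², b²⟩E` gives `G = ⟨a,
b⟩E`. An element of `⟨a, b⟩ ∩ E` lies in `N` and has trivial square. Elements `ac` with `c ∈ ⟨a²,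
b²⟩` have square `a² ≠ 1`, so it lies in `⟨a², b²⟩ ∩ E = 1`. -/
theorem IsTwistedPair.exists_decomposition {N : Subgroup G} {a b : G} (h : IsTwistedPair N a b)
    (h4 : ∀ g : G, g ^ 4 = 1) (hmul : ∀ x y, x ∉ N → y ∉ N → x * y ∈ N)
    (hN : ∀ x ∈ N, ∀ y ∈ N, x * y = y * x) :
    (∃ (E : Type u) (_ : Group E) (f : G ≃* QuaternionGroup 2 × E) (c : QuaternionGroup 2),
      IsElementaryAbelianTwoGroup E ∧ orderOf c = 4 ∧
      N.map f.toMonoidHom = (Subgroup.zpowers c).prod ⊤) ∨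
    (∃ (E : Type u) (_ : Group E) (f : G ≃* G16x4 × E),
      IsElementaryAbelianTwoGroup E ∧
      N.map f.toMonoidHom = (Subgroup.closure {G16x4.a, G16x4.b ^ 2}).prod ⊤) := by
  let K : Subgroup G :=
    { carrier := {m | m ∈ N ∧ m ^ 2 = 1}
      one_mem' := ⟨N.one_mem, one_pow 2⟩
      mul_mem' := fun {x y} hx hy => ⟨N.mul_mem hx.1 hy.1, by
        rw [Commute.mul_pow (hN x hx.1 y hy.1), hx.2, hy.2, one_mul]⟩
      inv_mem' := fun {x} hx => ⟨N.inv_mem hx.1, by rw [inv_pow, hx.2, inv_one]⟩ }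
  obtain ⟨E, hEK, hdisj, hsplit⟩ :=
    exists_complement_of_sq_eq_one (K := K) (fun k hk => hk.2) (Subgroup.closure {a ^ 2, b ^ 2})
  have hE2 : IsElementaryAbelianTwoGroup E := fun e => Subtype.ext (hEK e.2).2
  have hEN : E ≤ N := fun e he => (hEK he).1
  have haE : ∀ e ∈ E, a * e = e * a := fun e he => hN a h.left_mem e (hEN he)
  have hbE : ∀ e ∈ E, b * e = e * b := fun e he =>
    (h.involution_comm e (hEN he) (hEK he).2).symm
  have hclE : ∀ w ∈ Subgroup.closure {a, b}, ∀ e ∈ E, w * e = e * w := by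
    intro w hw e he
    have hle : Subgroup.closure {a, b} ≤ Subgroup.centralizer {e} := by
      rw [Subgroup.closure_le]
      rintro x (rfl | rfl)
      · exact Subgroup.mem_centralizer_singleton_iff.2 (haE e he)
      · exact Subgroup.mem_centralizer_singleton_iff.2 (hbE e he)
    exact Subgroup.mem_centralizer_singleton_iff.1 (hle hw)
  have hb2N : b ^ 2 ∈ N := by rw [sq]; exact hmul b b h.right_not_mem h.right_not_mem
  have htop : ∀ S : Subgroup G, a ∈ S → b ∈ S → E ≤ S → S = ⊤ := by
    intro S ha hb hE
    have hH : Subgroup.closure {a ^ 2, b ^ 2} ≤ S := by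
      rw [Subgroup.closure_le]
      rintro x (rfl | rfl)
      · exact S.pow_mem ha 2
      · exact S.pow_mem hb 2
    have hK : ∀ m ∈ N, m ^ 2 = 1 → m ∈ S := by
      intro m hm hm2
      obtain ⟨x, hx, e, he, rfl⟩ := hsplit m ⟨hm, hm2⟩
      exact S.mul_mem (hH hx) (hE he)
    have hNS : N ≤ S := by
      intro m hm
      rcases h.sq_eq_one_or m hm with h2 | h2
      · exact hK m hm h2
      · exact (Subgroup.mul_mem_cancel_left _ (S.inv_mem ha)).1
          (hK _ (N.mul_mem (N.inv_mem h.left_mem) hm) h2)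
    rw [Subgroup.eq_top_iff']
    intro g
    by_cases hg : g ∈ N
    · exact hNS hg
    · exact (Subgroup.mul_mem_cancel_left _ hb).1 (hNS (hmul b g h.right_not_mem hg))
  have haN := h.left_mem
  have hbN := h.right_not_mem
  have hHN : ∀ i j : ℕ, (a ^ 2) ^ i * (b ^ 2) ^ j ∈ N := fun i j =>
    N.mul_mem (N.pow_mem (N.pow_mem haN 2) i) (N.pow_mem hb2N j)
  have hbc : ∀ i j : ℕ, b * ((a ^ 2) ^ i * (b ^ 2) ^ j) ∉ N := fun i j hh =>
    hbN ((Subgroup.mul_mem_cancel_right _ (hHN i j)).1 hh)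
  have habc : ∀ i j : ℕ, a * b * ((a ^ 2) ^ i * (b ^ 2) ^ j) ∉ N := fun i j hh => by
    rw [mul_assoc] at hh
    exact hbc i j ((Subgroup.mul_mem_cancel_left _ haN).1 hh)
  have hasq : ∀ x : G, x ∈ N → x ^ 2 = 1 → a * x ∉ E := by
    intro x hx hx2 hE
    have := (hEK hE).2
    rw [Commute.mul_pow (hN a haN x hx), hx2, mul_one] at this
    exact h.left_sq_ne this
  have ha22 : (a ^ 2) ^ 2 = 1 := by rw [← pow_mul]; exact h4 a
  have hb22 : (b ^ 2) ^ 2 = 1 := by rw [← pow_mul]; exact h4 b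
  by_cases hsq : a ^ 2 = b ^ 2
  · left
    let φ := quaternionHom a b (h4 a) h.mul_eq hsq
    have hφa : ∀ i, φ (QuaternionGroup.a i) = a ^ i.val := fun _ => rfl
    have hφx : ∀ i, φ (QuaternionGroup.xa i) = b * a ^ i.val := fun _ => rfl
    have hφN : ∀ w, w ∈ Subgroup.zpowers (QuaternionGroup.a 1 : QuaternionGroup 2) ↔ φ w ∈ N := by
      rintro (i | i)
      · rw [hφa]
        refine iff_of_true ?_ (N.pow_mem haN _)
        refine ⟨(i.val : ℤ), ?_⟩
        change QuaternionGroup.a 1 ^ (i.val : ℤ) = _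
        rw [zpow_natCast, QuaternionGroup.a_one_pow, ZMod.natCast_zmod_val]
      · rw [hφx]
        refine iff_of_false ?_ fun hh =>
          hbN ((Subgroup.mul_mem_cancel_right _ (N.pow_mem haN _)).1 hh)
        rw [← mem_powers_iff_mem_zpowers]
        rintro ⟨k, hk⟩
        change QuaternionGroup.a 1 ^ k = _ at hk
        rw [QuaternionGroup.a_one_pow] at hk
        cases hk
    have hprod : ∃ f : G ≃* QuaternionGroup 2 × E,
        N.map f.toMonoidHom = (Subgroup.zpowers (QuaternionGroup.a 1)).prod ⊤ := by
      refine exists_mulEquiv_prod φ E N _ ?_ ?_ hEN hφN ?_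
      · intro w e he
        refine hclE _ ?_ e he
        have hA : a ∈ Subgroup.closure {a, b} := Subgroup.subset_closure (by simp)
        have hB : b ∈ Subgroup.closure {a, b} := Subgroup.subset_closure (by simp)
        rcases w with i | i
        · exact Subgroup.pow_mem _ hA _
        · exact Subgroup.mul_mem _ hB (Subgroup.pow_mem _ hA _)
      · intro w hw
        have hwN := (hφN w).2 (hEN hw)
        rcases w with i | i
        · rw [hφa] at hw
          have hi : ∀ i : ZMod (2 * 2), i = 0 ∨ i = 1 ∨ i = 2 ∨ i = 3 := by decide
          have ha1 : a ∉ E := fun hE => h.left_sq_ne (hEK hE).2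
          rcases hi i with rfl | rfl | rfl | rfl
          · rfl
          · have hw' : a ^ 1 ∈ E := hw
            exact absurd hw' (by rwa [pow_one])
          · exact absurd (hdisj (a ^ 2) (Subgroup.subset_closure (by simp)) hw) h.left_sq_ne
          · have ha3 : a ^ 3 = a⁻¹ := by rw [eq_inv_iff_mul_eq_one, ← pow_succ, h4]
            have hw' : a ^ 3 ∈ E := hw
            rw [ha3, inv_mem_iff] at hw'
            exact absurd hw' ha1
        · exact absurd ((Subgroup.mul_mem_cancel_right _ (N.pow_mem haN _)).1 (hEN hw)) hbN
      · intro S hS hES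
        refine htop S (hS ⟨QuaternionGroup.a 1, ?_⟩) (hS ⟨QuaternionGroup.xa 0, ?_⟩) hES
        · rw [hφa]; exact pow_one a
        · rw [hφx]; simp
    obtain ⟨f, hf⟩ := hprod
    exact ⟨E, inferInstance, f, QuaternionGroup.a 1, hE2, QuaternionGroup.orderOf_a_one, hf⟩
  · right
    let φ := G16x4.lift a b (h4 a) (h4 b) h.mul_eq
    have hφa : φ G16x4.a = a := G16x4.lift_a _ _ _
    have hφb : φ G16x4.b = b := G16x4.lift_b _ _ _
    have hnf := fun w => exists_normal_form G16x4.a_pow_four G16x4.b_pow_four G16x4.a_mul_b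
      (w := w) (G16x4.closure_eq_top ▸ Subgroup.mem_top w)
    have hHM : ∀ i j : ℕ, (G16x4.a ^ 2) ^ i * (G16x4.b ^ 2) ^ j ∈
        Subgroup.closure {G16x4.a, G16x4.b ^ 2} := fun i j =>
      Subgroup.mul_mem _
        (Subgroup.pow_mem _ (Subgroup.pow_mem _ (Subgroup.subset_closure (by simp)) _) _)
        (Subgroup.pow_mem _ (Subgroup.subset_closure (by simp)) _)
    have hMN : ∀ w ∈ Subgroup.closure {G16x4.a, G16x4.b ^ 2}, φ w ∈ N := by
      have : Subgroup.closure {G16x4.a, G16x4.b ^ 2} ≤ N.comap φ := by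
        rw [Subgroup.closure_le]
        rintro x (rfl | rfl)
        · change φ _ ∈ N
          rw [hφa]; exact haN
        · change φ _ ∈ N
          rw [map_pow, hφb]; exact hb2N
      exact fun w hw => this hw
    have hprod : ∃ f : G ≃* G16x4 × E,
        N.map f.toMonoidHom = (Subgroup.closure {G16x4.a, G16x4.b ^ 2}).prod ⊤ := by
      refine exists_mulEquiv_prod φ E N _ ?_ ?_ hEN ?_ ?_
      · intro w e he
        refine hclE _ ?_ e he
        have : (⊤ : Subgroup G16x4) ≤ (Subgroup.closure {a, b}).comap φ := by
          rw [← G16x4.closure_eq_top, Subgroup.closure_le]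
          rintro x (rfl | rfl)
          · exact Subgroup.subset_closure (by simp [hφa])
          · exact Subgroup.subset_closure (by simp [hφb])
        exact this (Subgroup.mem_top w)
      · intro w hw
        obtain ⟨i, j, rfl | rfl | rfl | rfl⟩ := hnf w <;>
          simp only [map_mul, map_pow, hφa, hφb] at hw
        · have h1 := hdisj _ (Subgroup.mul_mem _
            (Subgroup.pow_mem _ (Subgroup.subset_closure (by simp)) i)
            (Subgroup.pow_mem _ (Subgroup.subset_closure (by simp)) j)) hw
          have hA2 : (G16x4.a ^ 2) ^ 2 = 1 := by rw [← pow_mul]; exact G16x4.a_pow_four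
          have hB2 : (G16x4.b ^ 2) ^ 2 = 1 := by rw [← pow_mul]; exact G16x4.b_pow_four
          -- Since `a²` and `b²` are distinct involutions, the word is trivial in `G` only if `i`
          -- and `j` are even, and then it is trivial in `G16x4`.
          rcases Nat.even_or_odd' i with ⟨k, rfl | rfl⟩ <;>
            rcases Nat.even_or_odd' j with ⟨l, rfl | rfl⟩ <;>
            simp only [pow_succ _ (2 * _), pow_mul _ 2, ha22, hb22, hA2, hB2, one_pow, one_mul,
              mul_one] at h1 ⊢
          · exact absurd h1 h.right_sq_ne
          · exact absurd h1 h.left_sq_ne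
          · rw [mul_eq_one_iff_eq_inv, inv_eq_self_of_sq hb22] at h1
            exact absurd h1 hsq
        · refine absurd hw (hasq _ (hHN i j) ?_)
          rw [Commute.mul_pow (hN _ (N.pow_mem (N.pow_mem haN 2) i) _ (N.pow_mem hb2N j)),
            pow_right_comm _ i, pow_right_comm _ j, ha22, hb22, one_pow, one_pow, one_mul]
        · exact absurd (hEN hw) (hbc i j)
        · exact absurd (hEN hw) (habc i j)
      · intro w
        refine ⟨hMN w, fun hw => ?_⟩
        obtain ⟨i, j, rfl | rfl | rfl | rfl⟩ := hnf w
        · exact hHM i j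
        · exact Subgroup.mul_mem _ (Subgroup.subset_closure (by simp)) (hHM i j)
        · simp only [map_mul, map_pow, hφa, hφb] at hw
          exact absurd hw (hbc i j)
        · simp only [map_mul, map_pow, hφa, hφb] at hw
          exact absurd hw (habc i j)
      · intro S hS hES
        exact htop S (hS ⟨G16x4.a, hφa⟩) (hS ⟨G16x4.b, hφb⟩) hES
    obtain ⟨f, hf⟩ := hprod
    exact ⟨E, inferInstance, f, hE2, hf⟩

end Decomposition

/-! ### The case of elementary abelian `N`, and the theorem -/

theorem not_mem_of_elementaryAbelian_of_two_torsion {R : Type*} [CommRing R] {G : Type*} [Group G]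
    {σ : G →* ℤˣ} (hG : ¬ ∀ x y : G, x * y = y * x)
    (hσ : ∃ x, x ∉ σ.ker)
    (hmul : ∀ x y, x ∉ σ.ker → y ∉ σ.ker → x * y ∈ σ.ker)
    (hcomm : ∀ x ∈ antisymmetricElements R σ, ∀ y ∈ antisymmetricElements R σ, x * y = y * x)
    (hN : ∀ n ∈ σ.ker, n ^ 2 = 1) {r : R} (hr : 2 * r = 0) : r = 0 := by
  by_contra hr0
  have key : ∀ x n, x ∉ σ.ker → n ∈ σ.ker → n * x = x * n ∨ n * x = x⁻¹ * n := fun x n hx hn =>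
    commute_or_of_two_torsion hcomm hr hr0 hx hn (hN n hn)
  obtain ⟨x, hx⟩ := hσ
  obtain ⟨n, hn, hnx⟩ := exists_mem_not_comm hmul (mul_comm_of_sq_eq_one hN) hG hx
  have hnx' : n * x ∉ σ.ker := fun h => hx ((Subgroup.mul_mem_cancel_left _ hn).1 h)
  have e1 := (key x n hx hn).resolve_left hnx
  -- Applied to `nx`, the twist gives `n(nx) = (nx)⁻¹n = x⁻¹`, so `x = x⁻¹`, and `nx = x⁻¹n` becomes
  -- commutation.
  have e2 := (key (n * x) n hnx' hn).resolve_left fun e => hnx (by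
    rw [mul_assoc] at e
    exact mul_left_cancel e)
  rw [mul_inv_rev, inv_mul_cancel_right, ← mul_assoc, ← sq, hN n hn, one_mul] at e2
  exact hnx (e1.trans (by rw [← e2]))

theorem theorem5p3 {R : Type*} [CommRing R] [Nontrivial R] (hR : ringChar R ≠ 2)
    {G : Type u} [Group G] (hG : ¬ ∀ x y : G, x * y = y * x) (hexp : Monoid.exponent G = 4)
    (σ : G →* ℤˣ) (hσ : σ ≠ 1)
    (hN : ∀ x ∈ σ.ker, ∀ y ∈ σ.ker, x * y = y * x) :
    (∀ x ∈ antisymmetricElements R σ, ∀ y ∈ antisymmetricElements R σ, x * y = y * x) ↔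
      (twoTorsionSet R = {0} ∧ IsElementaryAbelianTwoGroup σ.ker) ∨
      (∃ (E : Type u) (_ : Group E) (f : G ≃* QuaternionGroup 2 × E) (c : QuaternionGroup 2),
        IsElementaryAbelianTwoGroup E ∧ orderOf c = 4 ∧
        σ.ker.map f.toMonoidHom = (Subgroup.zpowers c).prod ⊤) ∨
      (∃ (E : Type u) (_ : Group E) (f : G ≃* G16x4 × E),
        IsElementaryAbelianTwoGroup E ∧
        (σ.ker.map f.toMonoidHom =
            (Subgroup.closure {G16x4.a, G16x4.b ^ 2}).prod ⊤ ∨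
          σ.ker.map f.toMonoidHom =
            (Subgroup.closure {G16x4.a * G16x4.b, G16x4.b ^ 2}).prod ⊤)) := by
  constructor
  · intro hcomm
    have h2 : (2 : R) ≠ 0 := Ring.two_ne_zero hR
    have h4 : ∀ g : G, g ^ 4 = 1 := fun g => hexp ▸ Monoid.pow_exponent_eq_one g
    have hmul : ∀ x y, x ∉ σ.ker → y ∉ σ.ker → x * y ∈ σ.ker := by
      intro x y hx hy
      rw [MonoidHom.mem_ker, map_mul, not_mem_ker_iff.1 hx, not_mem_ker_iff.1 hy]; rfl
    have hne : ∃ x, x ∉ σ.ker := by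
      by_contra! h
      exact hσ (MonoidHom.ext h)
    by_cases hel : ∀ n ∈ σ.ker, n ^ 2 = 1
    · refine Or.inl ⟨?_, fun n => Subtype.ext (hel n n.2)⟩
      ext r
      refine ⟨fun hr => ?_, ?_⟩
      · exact not_mem_of_elementaryAbelian_of_two_torsion hG hne hmul hcomm hel hr
      · rintro rfl
        exact mul_zero 2
    · push Not at hel
      right
      have hout : ∀ x, x ∉ σ.ker → x ^ 2 ≠ 1 := by
        intro x hx hx2
        obtain ⟨n, hn, hn2, hnx⟩ := exists_sq_ne_one_not_comm hmul hN hG hel hx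
        exact hnx (commute_involution hcomm h2 hx hx2 hn hn2)
      obtain ⟨a, b, hab⟩ := exists_isTwistedPair h4 hmul hN hG hel hne hout
        (fun x n hx hn hn2 hxn => commute_or_of_sq_ne hcomm h2 hx (hout x hx) hn hn2 hxn)
        (fun x y hx hy => mul_eq_of_not_mem_ker hcomm h2 hx (hout x hx) hy (hout y hy))
      rcases hab.exists_decomposition h4 hmul hN with h | ⟨E, i, f, hE, hf⟩
      · exact Or.inl h
      -- The first form suffices: `a ↦ ab`, `b ↦ b` defines an automorphism of `G16x4` carrying `⟨a,
      -- b²⟩` to `⟨ab, b²⟩`.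
      · exact Or.inr ⟨E, i, f, hE, Or.inl hf⟩
  · rintro (⟨h2, hel⟩ | ⟨E, _, f, c, hE, hc, hf⟩ | ⟨E, _, f, hE, hf | hf⟩)
    · exact antisymmetricElements_commute_of_elementaryAbelian h2 fun n hn =>
        congrArg Subtype.val (hel ⟨n, hn⟩)
    · exact antisymmetricElements_commute_of_hasCentralSquares hN
        (.of_mulEquiv_prod hE f hf (QuaternionGroup.hasCentralSquares_zpowers hc))
    · exact antisymmetricElements_commute_of_hasCentralSquares hN
        (.of_mulEquiv_prod hE f hf G16x4.hasCentralSquares_left)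
    · exact antisymmetricElements_commute_of_hasCentralSquares hN
        (.of_mulEquiv_prod hE f hf G16x4.hasCentralSquares_right)
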